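/- \textbf{Setting.} Let $(\mathbb T_n)$ be a refining sequence of partitions of $[0,1]$, i.e. finite sets $\{0,1\}\subset\mathbb T_1\subset\mathbb T_2\subset\cdots\subset[0,1]$ whose mesh tends to $0$. For $s\in\mathbb T_n$, $s<1$, let $s'$ be the successor of $s$ in $\mathbb T_n$, and let $s'=1$ if $s=1$. A function $x\in C[0,1]$ admits the quadratic variation $\langle x\rangle_t$ at $t$ if the limit $\langle x\rangle_t=\lim_n\sum_{s\in\mathbb T_n,\,s\le t}(x(s')-x(s))^2$ exists. The integral $\int_0^t\eta(s)\,dx(s)$ is the limit $\lim_n\sum_{s\in\mathbb T_n,\,s\le t}\eta(s)(x(s')-x(s))$. A function $\eta$ on $[0,1]$ is an \emph{admissible integrand} for $x$ if there are $n\in\mathbb N$, a continuous $\mathbf A:[0,1]\to\mathbb R^n$ with components of bounded variation, an open set $U\subset\mathbb R^n\times\mathbb R$ with $(\mathbf A(t),x(t))\in U$ for all $t$, and a function $f\in C^1(U)$ that is twice continuously differentiable in its last variable $\xi$, with $\partial^2 f/\partial\xi^2$ continuous on $U$, such that $\eta(t)=\frac{\partial f}{\partial\xi}(\mathbf A(t),x(t))$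 for all $t$. A function $z\in C[0,1]$ is a \emph{solution} of $dz(t)=\sigma(t,z(t))\,dx(t)+b(t)\,dt$ with $z(0)=z_0$ if $t\mapsto\sigma(t,z(t))$ is an admissible integrand for $x$ and, for all $t\in[0,1]$, the integral $\int_0^t\sigma(s,z(s))\,dx(s)$ exists and $z(t)=z_0+\int_0^t\sigma(s,z(s))\,dx(s)+\int_0^tb(s)\,ds$. \textbf{Corollary.} Let $I\supset[0,1]$ be an open interval and let $\sigma\in C^2(I\times\mathbb R)$ have bounded first partial derivatives $\sigma_t$ and $\sigma_\xi$ on $I\times\mathbb R$. Let $x\in C[0,1]$ satisfy $x(0)=0$ and $\langle x\rangle_t=t$ for all $t\in[0,1]$ along $(\mathbb T_n)$. Then the following holds. (a) For all $z_0,z_1\in\mathbb R$ and $t_0\in(0,1]$ there is $b\in\mathbb R$ such that the equation $dz(t)=\sigma(t,z(t))\,dx(t)+b\,dt$, $z(0)=z_0$, has a unique solution $z$, and this solution satisfies $z(t_0)=z_1$. (b) The set of all solutions of the equations $dz(t)=\sigma(t,z(t))\,dx(t)+b(t)\,dt$, where $b$ ranges over $C[0,1]$ and the initial value over $\mathbb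 R$, is dense in $C[0,1]$ with respect to the supremum norm. In particular, the set of all $z\in C[0,1]$ that admit, along $(\mathbb T_n)$, the quadratic variation $\langle z\rangle_t=\int_0^t\sigma^2(s,z(s))\,ds$ for all $t\in[0,1]$ is dense in $C[0,1]$, and for all $0\le t_0<t_1\le1$ and $z_0,z_1\in\mathbb R$ it contains a function $z$ with $z(t_0)=z_0$ and $z(t_1)=z_1$. -/

import Mathlib

open Filter Topology

noncomputable section

namespace PathwiseIto

/-- The successor of `s` in the finite set `P`: the least element of `P` larger than `s`,
and `1` if there is no such element. -/
def succIn (P : Finset unitInterval) (s : unitInterval) : unitInterval :=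
  if h : (P.filter (fun t => s < t)).Nonempty then (P.filter (fun t => s < t)).min' h else 1

/-- A refining sequence of partitions of `[0,1]`: an increasing sequence of finite subsets of
`[0,1]` containing both end points, whose mesh tends to zero. -/
structure RefiningPartitions where
  part : ℕ → Finset unitInterval
  zero_mem : ∀ n, 0 ∈ part n
  one_mem : ∀ n, 1 ∈ part n
  mono : Monotone part
  mesh : ∀ ε : ℝ, 0 < ε → ∃ N, ∀ n, N ≤ n → ∀ s ∈ part n,
    (succIn (part n) s : ℝ) - (s : ℝ) < ε

/-- `∑ η(s) (x(s') - x(s))` over the points `s ≤ t` of the finite set `P`. -/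
def riemannSum (P : Finset unitInterval) (η x : unitInterval → ℝ) (t : unitInterval) : ℝ :=
  ∑ s ∈ P.filter (fun s => s ≤ t), η s * (x (succIn P s) - x s)

/-- `∑ (x(s') - x(s)) ^ 2` over the points `s ≤ t` of the finite set `P`. -/
def squareSum (P : Finset unitInterval) (x : unitInterval → ℝ) (t : unitInterval) : ℝ :=
  ∑ s ∈ P.filter (fun s => s ≤ t), (x (succIn P s) - x s) ^ 2

/-- `x` admits the quadratic variation `q t` along `T` at every `t ∈ [0,1]`. -/
def HasQuadVar (T : RefiningPartitions) (x : C(unitInterval, ℝ)) (q : unitInterval → ℝ) : Prop :=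
  ∀ t, Tendsto (fun n => squareSum (T.part n) x t) atTop (𝓝 (q t))

/-- The integral `∫₀ᵗ η(s) dx(s)` exists along `T`, as the limit of the non-anticipative
Riemann sums, and has the value `v`. -/
def HasFollmerIntegral (T : RefiningPartitions) (x : C(unitInterval, ℝ)) (η : unitInterval → ℝ)
    (t : unitInterval) (v : ℝ) : Prop :=
  Tendsto (fun n => riemannSum (T.part n) η x t) atTop (𝓝 v)

/-- `η` is an admissible integrand for `x`: `η(t) = ∂f/∂ξ (A(t), x(t))`, where `A` is a continuous
path of bounded variation in `ℝⁿ` and `f` is of class `C^{1,2}` in `(a, ξ)` on an open set `U`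
that contains the path `(A(t), x(t))`. -/
def IsAdmissibleIntegrand (x : C(unitInterval, ℝ)) (η : unitInterval → ℝ) : Prop :=
  ∃ (n : ℕ) (A : unitInterval → Fin n → ℝ) (U : Set ((Fin n → ℝ) × ℝ))
    (f : (Fin n → ℝ) × ℝ → ℝ),
    Continuous A ∧
    (∀ i, BoundedVariationOn (fun t => A t i) Set.univ) ∧
    IsOpen U ∧
    (∀ t, (A t, x t) ∈ U) ∧
    ContDiffOn ℝ 1 f U ∧
    (∀ a, ContDiffOn ℝ 2 (fun ξ => f (a, ξ)) {ξ | (a, ξ) ∈ U}) ∧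
    ContinuousOn (fun p : (Fin n → ℝ) × ℝ => iteratedDeriv 2 (fun ξ => f (p.1, ξ)) p.2) U ∧
    ∀ t, η t = deriv (fun ξ => f (A t, ξ)) (x t)

/-- `∫₀ᵗ g(s) ds` for a function `g` on `[0,1]`. -/
def timeIntegral (g : unitInterval → ℝ) (t : unitInterval) : ℝ :=
  ∫ s in (0 : ℝ)..(t : ℝ), g (Set.projIcc 0 1 zero_le_one s)

/-- `z` solves `dz(t) = σ(t, z(t)) dx(t) + b(t, z(t)) dt` with `z(0) = z₀`. -/
def IsItoSolution (T : RefiningPartitions) (x : C(unitInterval, ℝ))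
    (σ b : unitInterval → ℝ → ℝ) (z₀ : ℝ) (z : C(unitInterval, ℝ)) : Prop :=
  IsAdmissibleIntegrand x (fun t => σ t (z t)) ∧
  ∃ J : unitInterval → ℝ,
    (∀ t, HasFollmerIntegral T x (fun s => σ s (z s)) t (J t)) ∧
    ∀ t, z t = z₀ + J t + timeIntegral (fun s => b s (z s)) t

/-- The functions `z` with local quadratic variation `⟨z⟩_t = ∫₀ᵗ β(s, z(s)) ds`. -/
def localQuadVarClass (T : RefiningPartitions) (β : unitInterval → ℝ → ℝ) :
    Set C(unitInterval, ℝ) :=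
  {z | HasQuadVar T z (timeIntegral (fun s => β s (z s)))}

end PathwiseIto

end

/-! The proof is the Doss–Sussmann method, carried out with exact finite increments. After a
reparametrization of time (`exists_time_cutoff`), `σ` may be taken on all of `ℝ × ℝ` with bounded
first derivatives. Let `φ(t, ξ, ·)` be the flow of the field `σ(t, ·)` started at `ξ`. For a `C¹`
path `B`, Itô's formula for `z(t) = φ(t, B(t), x(t))` reads `dz = σ(t, z) dx + φ_ξ dB + (φ_t + ½
φ_ττ) dt`. Hence `z` solves the equation with drift `b` exactly when `B' = φ_ξ⁻¹ (b - φ_t - ½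
φ_ττ)`, an ordinary differential equation. Since `φ(t, ·, τ)` has inverse `φ(t, ·, -τ)`, every
continuous `z` is of this form for a unique continuous `B`.

Itô's formula is replaced by an algebraic identity (`ParamFlow.path_increment`) with continuous
coefficients `P, Q, R` in front of the increments of `B`, of time, and of `x` squared. The limit is
then weak convergence of discrete measures (`ConvWeights.mul_left`). The converse direction, needed
for uniqueness, solves the same identity for the increments of `B`. It requires the weights `Δz - σ
Δx` to have bounded total variation, which is what admissibility of the integrand provides
(`IsItoSolution.convWeights`).

For (a), solutions of the ordinary equation depend continuously on the constant `b`, and a large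
`|b|` pushes them beyond any target, so the intermediate value theorem applies
(`DriftCoeffs.exists_hits`). For (b), `B ↦ z` is a continuous surjection of `C[0,1]`, so it maps the
dense set of `C¹` paths onto a dense set. The same paths have quadratic variation `∫ σ²`, and an
affine `B` connects two prescribed points. -/

noncomputable section

namespace PathwiseIto

/-! ### Continuous difference quotients -/

/-- `∫₀¹ g'(p, u + θ (v - u)) dθ`: the difference quotient between `u` and `v` of a primitive of
`g'(p, ·)`. -/
def meanSlope {X : Type*} (g' : X × ℝ → ℝ) (q : X × ℝ × ℝ) : ℝ :=
  ∫ θ in (0 : ℝ)..1, g' (q.1, q.2.1 + θ * (q.2.2 - q.2.1))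

theorem meanSlope_self {X : Type*} (g' : X × ℝ → ℝ) (p : X) (u : ℝ) :
    meanSlope g' (p, u, u) = g' (p, u) := by
  simp [meanSlope]

theorem abs_meanSlope_le {X : Type*} {g' : X × ℝ → ℝ} {M : ℝ} (hM : ∀ q, |g' q| ≤ M)
    (q : X × ℝ × ℝ) : |meanSlope g' q| ≤ M := by
  have := intervalIntegral.norm_integral_le_of_norm_le_const (a := 0) (b := 1)
    (f := fun θ => g' (q.1, q.2.1 + θ * (q.2.2 - q.2.1))) (C := M) (fun θ _ => hM _)
  simpa [meanSlope] using this

/-- Second order version of `meanSlope`. -/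
def meanSlope₂ {X : Type*} (g'' : X × ℝ → ℝ) (q : X × ℝ × ℝ) : ℝ :=
  ∫ θ in (0 : ℝ)..1, θ * meanSlope g'' (q.1, q.2.1, q.2.1 + θ * (q.2.2 - q.2.1))

theorem meanSlope₂_self {X : Type*} (g'' : X × ℝ → ℝ) (p : X) (u : ℝ) :
    meanSlope₂ g'' (p, u, u) = g'' (p, u) / 2 := by
  simp [meanSlope₂, meanSlope_self]
  ring

section Slope

variable {X Y : Type*} [PseudoMetricSpace X] [PseudoMetricSpace Y]

theorem continuous_meanSlope {g' : X × ℝ → ℝ} (hg' : Continuous g') :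
    Continuous (meanSlope g') := by
  unfold meanSlope
  apply intervalIntegral.continuous_parametric_intervalIntegral_of_continuous'
  exact hg'.comp (by fun_prop)

theorem meanSlope_mul {g g' : X × ℝ → ℝ} (hg' : Continuous g')
    (h : ∀ p u, HasDerivAt (fun u => g (p, u)) (g' (p, u)) u) (p : X) (u v : ℝ) :
    g (p, v) - g (p, u) = meanSlope g' (p, u, v) * (v - u) := by
  have hd : ∀ θ ∈ Set.uIcc (0 : ℝ) 1, HasDerivAt (fun θ => g (p, u + θ * (v - u)))
      (g' (p, u + θ * (v - u)) * (v - u)) θ := by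
    intro θ _
    have h1 : HasDerivAt (fun θ : ℝ => u + θ * (v - u)) (v - u) θ := by
      simpa using ((hasDerivAt_id θ).mul_const (v - u)).const_add u
    exact (h p (u + θ * (v - u))).comp θ h1
  have hc : Continuous fun θ : ℝ => g' (p, u + θ * (v - u)) * (v - u) :=
    (hg'.comp (by fun_prop : Continuous fun θ : ℝ => (p, u + θ * (v - u)))).mul continuous_const
  have := intervalIntegral.integral_eq_sub_of_hasDerivAt hd (hc.intervalIntegrable _ _)
  rw [intervalIntegral.integral_mul_const] at this
  simpa [meanSlope] using this.symm

theorem continuous_meanSlope₂ {g'' : X × ℝ → ℝ} (hg'' : Continuous g'') :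
    Continuous (meanSlope₂ g'') := by
  unfold meanSlope₂
  apply intervalIntegral.continuous_parametric_intervalIntegral_of_continuous'
  exact continuous_snd.mul ((continuous_meanSlope hg'').comp (by fun_prop))

/-- The first order identity for `g'`, inserted under the integral defining `meanSlope g'`, gives
Taylor's formula. The point is the remainder coefficient: it is jointly continuous in the parameter
and both end points. -/
theorem meanSlope₂_mul {g g' g'' : X × ℝ → ℝ} (hg' : Continuous g') (hg'' : Continuous g'')
    (h : ∀ p u, HasDerivAt (fun u => g (p, u)) (g' (p, u)) u)
    (h' : ∀ p u, HasDerivAt (fun u => g' (p, u)) (g'' (p, u)) u) (p : X) (u v : ℝ) :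
    g (p, v) - g (p, u) = g' (p, u) * (v - u) + meanSlope₂ g'' (p, u, v) * (v - u) ^ 2 := by
  rw [meanSlope_mul hg' h]
  have h1 : ∀ θ : ℝ, g' (p, u + θ * (v - u)) = g' (p, u) +
      (θ * meanSlope g'' (p, u, u + θ * (v - u))) * (v - u) := by
    intro θ
    have := meanSlope_mul hg'' h' p u (u + θ * (v - u))
    linear_combination this
  have hc : Continuous fun θ : ℝ => θ * meanSlope g'' (p, u, u + θ * (v - u)) :=
    continuous_id.mul ((continuous_meanSlope hg'').comp (by fun_prop))
  have h2 : meanSlope g' (p, u, v) = g' (p, u) + meanSlope₂ g'' (p, u, v) * (v - u) := by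
    rw [meanSlope, intervalIntegral.integral_congr (fun θ _ => h1 θ),
      intervalIntegral.integral_add (by simp)
        (Continuous.intervalIntegrable (by fun_prop) _ _), intervalIntegral.integral_mul_const]
    simp [meanSlope₂]
  rw [h2]; ring

/-- `g(p, ·)` has difference quotients that extend continuously to the diagonal, jointly in `p`. -/
def HasContSlope (g : X × ℝ → ℝ) : Prop :=
  Continuous g ∧ ∃ Γ : X × ℝ × ℝ → ℝ, Continuous Γ ∧
    ∀ p u v, g (p, v) - g (p, u) = Γ (p, u, v) * (v - u)

theorem HasContSlope.of_hasDerivAt {g g' : X × ℝ → ℝ} (hg : Continuous g) (hg' : Continuous g')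
    (h : ∀ p u, HasDerivAt (fun u => g (p, u)) (g' (p, u)) u) : HasContSlope g :=
  ⟨hg, _, continuous_meanSlope hg', meanSlope_mul hg' h⟩

/-- Difference quotients obey an exact chain rule. Closure under such operations will yield local
Lipschitz bounds for the coefficients of the equation for `B`. -/
theorem HasContSlope.comp {h : Y × ℝ → ℝ} {g : X × ℝ → ℝ} {π : X → Y} (hh : HasContSlope h)
    (hg : HasContSlope g) (hπ : Continuous π) :
    HasContSlope fun q : X × ℝ => h (π q.1, g q) := by
  obtain ⟨hc, Γ, hΓ, h1⟩ := hh
  obtain ⟨gc, Δ, hΔ, h2⟩ := hg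
  refine ⟨by fun_prop, fun q => Γ (π q.1, g (q.1, q.2.1), g (q.1, q.2.2)) * Δ q, by fun_prop, ?_⟩
  intro p u v
  simp only [h1, h2]; ring

theorem HasContSlope.comp_param {h : Y × ℝ → ℝ} {π : X → Y} (hh : HasContSlope h)
    (hπ : Continuous π) : HasContSlope fun q : X × ℝ => h (π q.1, q.2) := by
  obtain ⟨hc, Γ, hΓ, h1⟩ := hh
  exact ⟨by fun_prop, fun q => Γ (π q.1, q.2), by fun_prop, fun p u v => h1 _ _ _⟩

theorem HasContSlope.neg {g : X × ℝ → ℝ} (hg : HasContSlope g) :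
    HasContSlope fun q => -g q := by
  obtain ⟨gc, Δ, hΔ, h2⟩ := hg
  exact ⟨by fun_prop, fun q => -Δ q, by fun_prop, fun p u v => by linear_combination -h2 p u v⟩

theorem HasContSlope.add {g k : X × ℝ → ℝ} (hg : HasContSlope g) (hk : HasContSlope k) :
    HasContSlope fun q => g q + k q := by
  obtain ⟨gc, Γ, hΓ, h1⟩ := hg
  obtain ⟨kc, Δ, hΔ, h2⟩ := hk
  exact ⟨by fun_prop, fun q => Γ q + Δ q, by fun_prop,
    fun p u v => by linear_combination h1 p u v + h2 p u v⟩

theorem HasContSlope.mul {g k : X × ℝ → ℝ} (hg : HasContSlope g) (hk : HasContSlope k) :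
    HasContSlope fun q => g q * k q := by
  obtain ⟨gc, Γ, hΓ, h1⟩ := hg
  obtain ⟨kc, Δ, hΔ, h2⟩ := hk
  exact ⟨by fun_prop, fun q => Γ q * k (q.1, q.2.2) + g (q.1, q.2.1) * Δ q, by fun_prop,
    fun p u v => by linear_combination k (p, v) * h1 p u v + g (p, u) * h2 p u v⟩

theorem HasContSlope.exp {g : X × ℝ → ℝ} (hg : HasContSlope g) :
    HasContSlope fun q => Real.exp (g q) := by
  have : HasContSlope fun q : Unit × ℝ => Real.exp q.2 :=
    .of_hasDerivAt (g' := fun q => Real.exp q.2) (by fun_prop) (by fun_prop)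
      fun p u => Real.hasDerivAt_exp u
  exact this.comp hg (π := fun _ => ()) continuous_const

theorem HasContSlope.const {g : X → ℝ} (hg : Continuous g) :
    HasContSlope fun q : X × ℝ => g q.1 :=
  ⟨by fun_prop, fun _ => 0, by fun_prop, by simp⟩

theorem HasContSlope.integral {g : (X × ℝ) × ℝ → ℝ} (hg : HasContSlope g) {τ : X → ℝ}
    (hτ : Continuous τ) :
    HasContSlope fun q : X × ℝ => ∫ s in (0 : ℝ)..τ q.1, g ((q.1, s), q.2) := by
  obtain ⟨gc, Γ, hΓ, h1⟩ := hg
  refine ⟨?_, fun q => ∫ s in (0 : ℝ)..τ q.1, Γ ((q.1, s), q.2), ?_, fun p u v => ?_⟩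
  · exact intervalIntegral.continuous_parametric_intervalIntegral_of_continuous
      (f := fun q : X × ℝ => fun s => g ((q.1, s), q.2)) (by fun_prop) (by fun_prop)
  · exact intervalIntegral.continuous_parametric_intervalIntegral_of_continuous
      (f := fun q : X × ℝ × ℝ => fun s => Γ ((q.1, s), q.2)) (by fun_prop) (by fun_prop)
  · rw [← intervalIntegral.integral_mul_const, ← intervalIntegral.integral_sub]
    · exact intervalIntegral.integral_congr fun s _ => h1 _ _ _
    · exact Continuous.intervalIntegrable (by fun_prop) _ _
    · exact Continuous.intervalIntegrable (by fun_prop) _ _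

end Slope

/-! ### The flow with parameters and its increments -/

/-- On the ball of radius `|v y| + 1` about `y` the speed is at most `(1 + M) (|v y| + 1)`, so
Picard–Lindelöf gives the existence time `(1 + M)⁻¹` for every starting point. A uniform existence
time allows continuation to all of `ℝ`. -/
theorem exists_global_integralCurve {v : ℝ → ℝ} (hv : ContDiff ℝ 1 v) {M : ℝ}
    (hM : ∀ u w, |v u - v w| ≤ M * |u - w|) (x : ℝ) :
    ∃ γ : ℝ → ℝ, γ 0 = x ∧ ∀ τ, HasDerivAt γ (v (γ τ)) τ := by
  have hM0 : 0 ≤ M := by simpa using (abs_nonneg _).trans (hM 1 0)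
  have hε : 0 < (1 + M)⁻¹ := by positivity
  have hloc : ∀ y : ℝ, ∃ γ : ℝ → ℝ, γ 0 = y ∧
      IsMIntegralCurveOn (I := modelWithCornersSelf ℝ ℝ) γ v (Set.Ioo (-(1 + M)⁻¹) (1 + M)⁻¹) := by
    intro y
    have hPL : IsPicardLindelof (fun _ => v) (tmin := -(1 + M)⁻¹) (tmax := (1 + M)⁻¹)
        ⟨0, by constructor <;> linarith⟩ y (⟨|v y| + 1, by positivity⟩ : NNReal) 0
        ⟨|v y| + M * (|v y| + 1), by positivity⟩ ⟨M, hM0⟩ := by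
      refine ⟨fun t _ => ?_, fun u _ => continuousOn_const, fun t _ u hu => ?_, ?_⟩
      · refine LipschitzOnWith.of_dist_le_mul fun u _ w _ => ?_
        rw [Real.dist_eq, Real.dist_eq]; exact hM u w
      · have h1 : |u - y| ≤ |v y| + 1 := by rw [← Real.dist_eq]; exact hu
        have h2 := hM u y
        have h3 : |v u| ≤ |v u - v y| + |v y| := by
          simpa using abs_add_le (v u - v y) (v y)
        have h4 := mul_le_mul_of_nonneg_left h1 hM0
        change |v u| ≤ |v y| + M * (|v y| + 1)
        linarith
      · have : (|v y| + M * (|v y| + 1)) * (1 + M)⁻¹ ≤ |v y| + 1 := by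
          rw [← div_eq_mul_inv, div_le_iff₀ (by positivity)]
          nlinarith [abs_nonneg (v y)]
        change _ * max _ _ ≤ _
        simp only [sub_zero, zero_sub, neg_neg, max_self, NNReal.coe_zero]
        exact this
    obtain ⟨γ, h0, hγ⟩ := hPL.exists_eq_forall_mem_Icc_hasDerivWithinAt₀
    refine ⟨γ, h0, fun t ht => ?_⟩
    exact ((hγ t (Set.Ioo_subset_Icc_self ht)).mono Set.Ioo_subset_Icc_self).hasFDerivWithinAt.hasMFDerivWithinAt
  obtain ⟨γ, h0, hγ⟩ := exists_isMIntegralCurve_of_isMIntegralCurveOn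
    (contMDiff_vectorSpace_iff_contDiff.mpr hv) hε hloc x
  refine ⟨γ, h0, fun τ => ?_⟩
  have h : HasFDerivAt γ ((1 : ℝ →L[ℝ] ℝ).smulRight (v (γ τ))) τ := (hγ τ).hasFDerivAt
  simpa using h.hasDerivAt

/-- Variation of constants: multiplying `D` by the integrating factor `exp (-∫ c)` leaves only the
inhomogeneity. It will be applied to the difference of two trajectories. -/
theorem exists_smul_exp_eq {D c a : ℝ → ℝ} (hc : Continuous c) (ha : Continuous a)
    (h : ∀ τ, HasDerivAt D (c τ * D τ + a τ) τ) (τ : ℝ) :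
    D τ = Real.exp (∫ s in (0 : ℝ)..τ, c s) *
      (D 0 + ∫ s in (0 : ℝ)..τ, Real.exp (-∫ r in (0 : ℝ)..s, c r) * a s) := by
  have hC : ∀ s, HasDerivAt (fun s => ∫ r in (0 : ℝ)..s, c r) (c s) s := fun s =>
    intervalIntegral.integral_hasDerivAt_right (hc.intervalIntegrable _ _)
      (hc.stronglyMeasurableAtFilter _ _) hc.continuousAt
  have hCc : Continuous fun s => ∫ r in (0 : ℝ)..s, c r :=
    continuous_iff_continuousAt.2 fun s => (hC s).continuousAt
  have hd : ∀ s ∈ Set.uIcc 0 τ, HasDerivAt (fun s => Real.exp (-∫ r in (0 : ℝ)..s, c r) * D s)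
      (Real.exp (-∫ r in (0 : ℝ)..s, c r) * a s) s := by
    intro s _
    exact (((hC s).fun_neg.exp).fun_mul (h s)).congr_deriv (by ring)
  have := intervalIntegral.integral_eq_sub_of_hasDerivAt hd
    (Continuous.intervalIntegrable (by fun_prop) _ _)
  rw [this]
  simp [Real.exp_neg]

theorem hasDerivAt_snd_of_contDiff {F : ℝ × ℝ → ℝ} (hF : ContDiff ℝ 1 F) (t u : ℝ) :
    HasDerivAt (fun y => F (t, y)) (fderiv ℝ F (t, u) (0, 1)) u :=
  ((hF.differentiable one_ne_zero).differentiableAt (x := (t, u))).hasFDerivAt.comp_hasDerivAt u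
    ((hasDerivAt_const u t).prodMk (hasDerivAt_id u))

theorem hasDerivAt_fst_of_contDiff {F : ℝ × ℝ → ℝ} (hF : ContDiff ℝ 1 F) (t u : ℝ) :
    HasDerivAt (fun s => F (s, u)) (fderiv ℝ F (t, u) (1, 0)) t :=
  ((hF.differentiable one_ne_zero).differentiableAt (x := (t, u))).hasFDerivAt.comp_hasDerivAt t
    ((hasDerivAt_id t).prodMk (hasDerivAt_const t u))

theorem hasContSlope_of_contDiff {F : ℝ × ℝ → ℝ} (hF : ContDiff ℝ 1 F) : HasContSlope F :=
  .of_hasDerivAt hF.continuous (g' := fun q => fderiv ℝ F q (0, 1))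
    ((hF.continuous_fderiv one_ne_zero).clm_apply continuous_const)
    (hasDerivAt_snd_of_contDiff hF)

/-- The flow `φ(t, ξ, τ)` of the equations `∂φ/∂τ = σ(t, φ)`, `φ(t, ξ, 0) = ξ`, together with
continuous difference quotients `P` in `ξ`, `Q` in `t`, and a continuous second order difference
quotient `R` in `τ`. -/
structure ParamFlow (σ : ℝ → ℝ → ℝ) where
  φ : ℝ × ℝ × ℝ → ℝ
  P : ℝ × ℝ × ℝ × ℝ × ℝ → ℝ
  Q : ℝ × ℝ × ℝ × ℝ × ℝ → ℝ
  R : ℝ × ℝ × ℝ × ℝ → ℝ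
  continuous_φ : Continuous φ
  continuous_P : Continuous P
  continuous_Q : Continuous Q
  continuous_R : Continuous R
  φ_zero : ∀ t ξ, φ (t, ξ, 0) = ξ
  hasDerivAt_φ : ∀ t ξ τ, HasDerivAt (fun τ => φ (t, ξ, τ)) (σ t (φ (t, ξ, τ))) τ
  φ_neg : ∀ t ξ τ, φ (t, φ (t, ξ, τ), -τ) = ξ
  P_pos : ∀ q, 0 < P q
  φ_increment : ∀ t t' ξ ξ' τ, φ (t', ξ', τ) - φ (t, ξ, τ) =
    P (t, t', ξ, ξ', τ) * (ξ' - ξ) + Q (t, t', ξ, ξ', τ) * (t' - t)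
  φ_taylor : ∀ t ξ τ τ', φ (t, ξ, τ') - φ (t, ξ, τ) =
    σ t (φ (t, ξ, τ)) * (τ' - τ) + R (t, ξ, τ, τ') * (τ' - τ) ^ 2
  slope_inv : HasContSlope fun q : (ℝ × ℝ) × ℝ => (P (q.1.1, q.1.1, q.2, q.2, q.1.2))⁻¹
  slope_drift : HasContSlope fun q : (ℝ × ℝ) × ℝ =>
    Q (q.1.1, q.1.1, q.2, q.2, q.1.2) + R (q.1.1, q.2, q.1.2, q.1.2)
  growth : ∀ T X : ℝ, ∃ K, 0 < K ∧ ∀ t ξ τ, |t| ≤ T → |τ| ≤ X →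
    P (t, t, ξ, ξ, τ) ≤ K ∧ (P (t, t, ξ, ξ, τ))⁻¹ ≤ K ∧
      |Q (t, t, ξ, ξ, τ) + R (t, ξ, τ, τ)| ≤ K * (1 + |ξ|)

theorem abs_sub_le_of_abs_deriv_le {v v' : ℝ → ℝ} {M : ℝ} (hv : ∀ u, HasDerivAt v (v' u) u)
    (hM : ∀ u, |v' u| ≤ M) (u w : ℝ) : |v u - v w| ≤ M * |u - w| := by
  have := Convex.norm_image_sub_le_of_norm_hasDerivWithin_le (f := v) (f' := v') (C := M)
    (s := Set.univ) (x := w) (y := u) (fun x _ => (hv x).hasDerivWithinAt)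
    (fun x _ => by simpa using hM x) convex_univ trivial trivial
  simpa using this

theorem exists_flow_curves {σ : ℝ → ℝ → ℝ} (hσ : ContDiff ℝ 2 fun p : ℝ × ℝ => σ p.1 p.2) {M : ℝ}
    (hM : ∀ t u, |deriv (fun y => σ t y) u| ≤ M) :
    ∃ φ : ℝ × ℝ × ℝ → ℝ, (∀ t ξ, φ (t, ξ, 0) = ξ) ∧
      ∀ t ξ τ, HasDerivAt (fun τ => φ (t, ξ, τ)) (σ t (φ (t, ξ, τ))) τ := by
  have h : ∀ t ξ, ∃ γ : ℝ → ℝ, γ 0 = ξ ∧ ∀ τ, HasDerivAt γ (σ t (γ τ)) τ := by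
    intro t ξ
    have h1 : ContDiff ℝ 1 (σ t) :=
      (hσ.of_le one_le_two).comp (contDiff_const.prodMk contDiff_id)
    refine exists_global_integralCurve h1 (M := M) ?_ ξ
    exact abs_sub_le_of_abs_deriv_le
      (fun u => (h1.differentiable one_ne_zero).differentiableAt.hasDerivAt) (hM t)
  choose γ h0 h1 using h
  exact ⟨fun q => γ q.1 q.2.1 q.2.2, h0, h1⟩

theorem abs_intervalIntegral_le {g : ℝ → ℝ} {M τ : ℝ} (hg : ∀ s, |s| ≤ |τ| → |g s| ≤ M) :
    |∫ s in (0 : ℝ)..τ, g s| ≤ M * |τ| := by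
  have := intervalIntegral.norm_integral_le_of_norm_le_const (a := 0) (b := τ) (f := g) (C := M)
    (fun s hs => hg s ?_)
  · simpa using this
  · rcases Set.mem_uIoc.1 hs with h | h
    · rw [abs_of_nonneg h.1.le, abs_of_nonneg (h.1.le.trans h.2)]; exact h.2
    · rw [abs_of_nonpos h.2, abs_of_nonpos (h.1.le.trans h.2)]; linarith [h.1]

/-- The difference `D` of two trajectories with data `(t, ξ)`, `(t', ξ')` satisfies the linear
equation `D' = c D + a (t' - t)`, where `c` and `a` are mean slopes of `σ` in space and time.
Variation of constants gives `P = exp (∫ c)` and the formula for `Q`. The coefficient `R` is the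
mean second slope in `τ`, since `∂²φ/∂τ² = σ_u σ` along the flow. -/
theorem nonempty_paramFlow {σ : ℝ → ℝ → ℝ} (hσ : ContDiff ℝ 2 fun p : ℝ × ℝ => σ p.1 p.2) {M : ℝ}
    (hMt : ∀ t u, |deriv (fun s => σ s u) t| ≤ M) (hMu : ∀ t u, |deriv (fun y => σ t y) u| ≤ M) :
    Nonempty (ParamFlow σ) := by
  obtain ⟨φ, φ0, hφ⟩ := exists_flow_curves hσ hMu
  have hM : 0 ≤ M := (abs_nonneg _).trans (hMu 0 0)
  set F : ℝ × ℝ → ℝ := fun p => σ p.1 p.2 with hF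
  have hF1 : ContDiff ℝ 1 F := hσ.of_le one_le_two
  have hDF : ContDiff ℝ 1 (fderiv ℝ F) := hσ.fderiv_right (by norm_num)
  -- the partial derivatives, each with its own variable last
  set σu : ℝ × ℝ → ℝ := fun q => fderiv ℝ F q (0, 1) with hσu
  set σt : ℝ × ℝ → ℝ := fun q => fderiv ℝ F (q.2, q.1) (1, 0) with hσt
  have σu_cd : ContDiff ℝ 1 σu := hDF.clm_apply contDiff_const
  have σt_cd : ContDiff ℝ 1 σt :=
    (hDF.comp (contDiff_snd.prodMk contDiff_fst)).clm_apply contDiff_const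
  have σt'_cd : ContDiff ℝ 1 fun q : ℝ × ℝ => σt (q.2, q.1) := hDF.clm_apply contDiff_const
  have dσu : ∀ t u, HasDerivAt (fun y => F (t, y)) (σu (t, u)) u := hasDerivAt_snd_of_contDiff hF1
  have dσt : ∀ u t, HasDerivAt (fun s => F (s, u)) (σt (u, t)) t :=
    fun u t => hasDerivAt_fst_of_contDiff hF1 t u
  have bσu : ∀ q, |σu q| ≤ M := fun q => by rw [← (dσu q.1 q.2).deriv]; exact hMu _ _
  have bσt : ∀ q, |σt q| ≤ M := fun q => by rw [← (dσt q.1 q.2).deriv]; exact hMt _ _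
  have cσu := continuous_meanSlope σu_cd.continuous
  have cσt := continuous_meanSlope σt_cd.continuous
  have hinc : ∀ t t' u u', F (t', u') - F (t, u) =
      meanSlope σu (t, u, u') * (u' - u) + meanSlope σt (u', t, t') * (t' - t) := by
    intro t t' u u'
    have h1 := meanSlope_mul (g := F) σu_cd.continuous dσu t u u'
    have h2 := meanSlope_mul (g := fun q => F (q.2, q.1)) σt_cd.continuous dσt u' t t'
    linear_combination h1 + h2
  have φc : ∀ t ξ, Continuous fun τ => φ (t, ξ, τ) := fun t ξ =>
    continuous_iff_continuousAt.2 fun τ => (hφ t ξ τ).continuousAt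
  -- coefficients of the linear equation for the difference of two trajectories
  set c : ℝ × ℝ × ℝ × ℝ × ℝ → ℝ := fun q =>
    meanSlope σu (q.1, φ (q.1, q.2.2.1, q.2.2.2.2), φ (q.2.1, q.2.2.2.1, q.2.2.2.2)) with hc
  set a : ℝ × ℝ × ℝ × ℝ × ℝ → ℝ := fun q =>
    meanSlope σt (φ (q.2.1, q.2.2.2.1, q.2.2.2.2), q.1, q.2.1) with ha
  set C : ℝ × ℝ × ℝ × ℝ × ℝ → ℝ := fun q =>
    ∫ s in (0 : ℝ)..q.2.2.2.2, c (q.1, q.2.1, q.2.2.1, q.2.2.2.1, s) with hC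
  set P : ℝ × ℝ × ℝ × ℝ × ℝ → ℝ := fun q => Real.exp (C q) with hP
  set Q : ℝ × ℝ × ℝ × ℝ × ℝ → ℝ := fun q => Real.exp (C q) * ∫ s in (0 : ℝ)..q.2.2.2.2,
    Real.exp (-C (q.1, q.2.1, q.2.2.1, q.2.2.2.1, s)) *
      a (q.1, q.2.1, q.2.2.1, q.2.2.2.1, s) with hQ
  have hincφ : ∀ t t' ξ ξ' τ, φ (t', ξ', τ) - φ (t, ξ, τ) =
      P (t, t', ξ, ξ', τ) * (ξ' - ξ) + Q (t, t', ξ, ξ', τ) * (t' - t) := by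
    intro t t' ξ ξ' τ
    have h1 := φc t ξ
    have h2 := φc t' ξ'
    have := exists_smul_exp_eq (D := fun τ => φ (t', ξ', τ) - φ (t, ξ, τ))
      (c := fun s => c (t, t', ξ, ξ', s)) (a := fun s => a (t, t', ξ, ξ', s) * (t' - t))
      (cσu.comp (continuous_const.prodMk (h1.prodMk h2)))
      (Continuous.mul (f := fun s => a (t, t', ξ, ξ', s))
        (cσt.comp (h2.prodMk (continuous_const (y := (t, t'))))) continuous_const)
      (fun τ => ((hφ t' ξ' τ).sub (hφ t ξ τ)).congr_deriv (hinc t t' _ _)) τ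
    simp only [φ0, ← mul_assoc, intervalIntegral.integral_mul_const] at this
    rw [this]
    simp only [hP, hQ, hC]
    ring
  have bC : ∀ q, |C q| ≤ M * |q.2.2.2.2| := fun q =>
    abs_intervalIntegral_le fun s _ => abs_meanSlope_le bσu _
  have bP : ∀ q, P q ≤ Real.exp (M * |q.2.2.2.2|) := fun q =>
    Real.exp_le_exp.2 ((le_abs_self _).trans (bC q))
  have bP' : ∀ q, (P q)⁻¹ ≤ Real.exp (M * |q.2.2.2.2|) := fun q => by
    rw [hP, ← Real.exp_neg]
    exact Real.exp_le_exp.2 ((neg_le_abs _).trans (bC q))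
  have bQ : ∀ q, |Q q| ≤ Real.exp (M * |q.2.2.2.2|) *
      (Real.exp (M * |q.2.2.2.2|) * M * |q.2.2.2.2|) := by
    intro q
    rw [hQ, abs_mul, Real.abs_exp]
    refine mul_le_mul (bP q) (abs_intervalIntegral_le fun s hs => ?_) (abs_nonneg _)
      (Real.exp_pos _).le
    rw [abs_mul, Real.abs_exp]
    refine mul_le_mul (Real.exp_le_exp.2 ?_) (abs_meanSlope_le bσt _) (abs_nonneg _)
      (Real.exp_pos _).le
    exact (neg_le_abs _).trans ((bC _).trans (mul_le_mul_of_nonneg_left hs hM))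
  -- The bounds on `P` and `Q` use only `|c|, |a| ≤ M`, so they are available before any joint
  -- continuity. They give continuity of `φ`, from which that of `c, a, P, Q` follows.
  have φ_cont : Continuous φ := by
    rw [continuous_iff_continuousAt]
    rintro ⟨t, ξ, τ⟩
    have key : ∀ q : ℝ × ℝ × ℝ, |φ q - φ (t, ξ, τ)| ≤
        (Real.exp (M * |q.2.2|) * |q.2.1 - ξ| + Real.exp (M * |q.2.2|) *
          (Real.exp (M * |q.2.2|) * M * |q.2.2|) * |q.1 - t|) +
        |φ (t, ξ, q.2.2) - φ (t, ξ, τ)| := by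
      rintro ⟨t', ξ', τ'⟩
      have h1 := hincφ t t' ξ ξ' τ'
      have h2 : |φ (t', ξ', τ') - φ (t, ξ, τ')| ≤ Real.exp (M * |τ'|) * |ξ' - ξ| +
          Real.exp (M * |τ'|) * (Real.exp (M * |τ'|) * M * |τ'|) * |t' - t| := by
        rw [h1]
        refine (abs_add_le _ _).trans (add_le_add ?_ ?_)
        · rw [abs_mul, abs_of_pos (Real.exp_pos _)]
          exact mul_le_mul_of_nonneg_right (bP _) (abs_nonneg _)
        · rw [abs_mul]
          exact mul_le_mul_of_nonneg_right (bQ _) (abs_nonneg _)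
      exact (abs_sub_le _ _ _).trans (add_le_add_left h2 _)
    have hlim : Tendsto (fun q : ℝ × ℝ × ℝ =>
        (Real.exp (M * |q.2.2|) * |q.2.1 - ξ| + Real.exp (M * |q.2.2|) *
          (Real.exp (M * |q.2.2|) * M * |q.2.2|) * |q.1 - t|) +
        |φ (t, ξ, q.2.2) - φ (t, ξ, τ)|) (𝓝 (t, ξ, τ)) (𝓝 0) := by
      have h1 := φc t ξ
      have : Continuous fun q : ℝ × ℝ × ℝ =>
        (Real.exp (M * |q.2.2|) * |q.2.1 - ξ| + Real.exp (M * |q.2.2|) *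
          (Real.exp (M * |q.2.2|) * M * |q.2.2|) * |q.1 - t|) +
        |φ (t, ξ, q.2.2) - φ (t, ξ, τ)| := by
        refine Continuous.add (by fun_prop) (Continuous.abs (Continuous.sub ?_ continuous_const))
        exact h1.comp (continuous_snd.comp continuous_snd)
      convert this.tendsto (t, ξ, τ) using 2
      simp
    refine tendsto_iff_dist_tendsto_zero.2 (squeeze_zero (fun _ => dist_nonneg) (fun q => ?_) hlim)
    rw [Real.dist_eq]; exact key q
  have c_cont : Continuous c := by simp only [hc]; fun_prop
  have a_cont : Continuous a := by simp only [ha]; fun_prop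
  have C_cont : Continuous C := by
    exact intervalIntegral.continuous_parametric_intervalIntegral_of_continuous
      (f := fun q : ℝ × ℝ × ℝ × ℝ × ℝ => fun s => c (q.1, q.2.1, q.2.2.1, q.2.2.2.1, s))
      (by fun_prop) (by fun_prop)
  have P_cont : Continuous P := by simp only [hP]; fun_prop
  have Q_cont : Continuous Q := by
    refine Continuous.mul P_cont ?_
    exact intervalIntegral.continuous_parametric_intervalIntegral_of_continuous
      (f := fun q : ℝ × ℝ × ℝ × ℝ × ℝ => fun s => Real.exp (-C (q.1, q.2.1, q.2.2.1, q.2.2.2.1, s))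
        * a (q.1, q.2.1, q.2.2.1, q.2.2.2.1, s)) (by fun_prop) (by fun_prop)
  have P_pos : ∀ q, 0 < P q := fun q => Real.exp_pos _
  -- second order expansion in `τ`
  set V : (ℝ × ℝ) × ℝ → ℝ := fun q => F (q.1.1, φ (q.1.1, q.1.2, q.2)) with hV
  set W : (ℝ × ℝ) × ℝ → ℝ := fun q => σu (q.1.1, φ (q.1.1, q.1.2, q.2)) * V q with hW
  have F_cont := hF1.continuous
  have σu_cont := σu_cd.continuous
  have V_cont : Continuous V := by simp only [hV]; fun_prop
  have W_cont : Continuous W := by simp only [hW]; fun_prop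
  set R : ℝ × ℝ × ℝ × ℝ → ℝ := fun q => meanSlope₂ W ((q.1, q.2.1), q.2.2) with hR
  have R_cont : Continuous R := (continuous_meanSlope₂ W_cont).comp (by fun_prop)
  have φ_taylor : ∀ t ξ τ τ', φ (t, ξ, τ') - φ (t, ξ, τ) =
      σ t (φ (t, ξ, τ)) * (τ' - τ) + R (t, ξ, τ, τ') * (τ' - τ) ^ 2 := by
    intro t ξ τ τ'
    exact meanSlope₂_mul (g := fun q : (ℝ × ℝ) × ℝ => φ (q.1.1, q.1.2, q.2)) V_cont W_cont
      (fun p u => hφ p.1 p.2 u) (fun p u => (dσu p.1 _).comp u (hφ p.1 p.2 u)) (t, ξ) τ τ'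
  -- regularity in `ξ` on the diagonal
  have sφ : HasContSlope fun q : (ℝ × ℝ) × ℝ => φ (q.1.1, q.2, q.1.2) := by
    refine ⟨by fun_prop, fun q => P (q.1.1, q.1.1, q.2.1, q.2.2, q.1.2), by fun_prop, ?_⟩
    intro p u v
    simpa using hincφ p.1 p.1 u v p.2
  have sσu : HasContSlope fun q : (ℝ × ℝ) × ℝ => σu (q.1.1, φ (q.1.1, q.2, q.1.2)) :=
    (hasContSlope_of_contDiff σu_cd).comp sφ (π := Prod.fst) continuous_fst
  have sσt : HasContSlope fun q : (ℝ × ℝ) × ℝ => σt (φ (q.1.1, q.2, q.1.2), q.1.1) :=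
    (hasContSlope_of_contDiff σt'_cd).comp sφ (π := Prod.fst) continuous_fst
  -- At coinciding arguments the mean slopes become partial derivatives of `σ` along `φ`. These are
  -- `C¹` functions of `φ`, and `φ` has the continuous slope `P` in `ξ`.
  have hcdiag : ∀ t ξ s, c (t, t, ξ, ξ, s) = σu (t, φ (t, ξ, s)) := fun t ξ s =>
    meanSlope_self _ _ _
  have hadiag : ∀ t ξ s, a (t, t, ξ, ξ, s) = σt (φ (t, ξ, s), t) := fun t ξ s =>
    meanSlope_self _ _ _
  have sC : HasContSlope fun q : (ℝ × ℝ) × ℝ => C (q.1.1, q.1.1, q.2, q.2, q.1.2) := by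
    have := (sσu.comp_param (π := fun p : (ℝ × ℝ) × ℝ => (p.1.1, p.2)) (by fun_prop)).integral
      (τ := Prod.snd) continuous_snd
    simpa only [hC, hcdiag] using this
  have sQ : HasContSlope fun q : (ℝ × ℝ) × ℝ => Q (q.1.1, q.1.1, q.2, q.2, q.1.2) := by
    have h1 := (sC.neg.exp.mul sσt).comp_param (π := fun p : (ℝ × ℝ) × ℝ => (p.1.1, p.2))
      (by fun_prop)
    have := sC.exp.mul (h1.integral (τ := Prod.snd) continuous_snd)
    simpa only [hQ, hadiag] using this
  have hRdiag : ∀ t ξ s, R (t, ξ, s, s) =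
      1 / 2 * (σu (t, φ (t, ξ, s)) * F (t, φ (t, ξ, s))) := by
    intro t ξ s
    simp only [hR, meanSlope₂_self, hW, hV]; ring
  have sF : HasContSlope fun q : (ℝ × ℝ) × ℝ => F (q.1.1, φ (q.1.1, q.2, q.1.2)) :=
    (hasContSlope_of_contDiff hF1).comp sφ (π := Prod.fst) continuous_fst
  have sR : HasContSlope fun q : (ℝ × ℝ) × ℝ => R (q.1.1, q.2, q.1.2, q.1.2) := by
    have := (HasContSlope.const (X := ℝ × ℝ) (g := fun _ => 1 / 2) continuous_const).mul
      (sσu.mul sF)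
    simpa only [hRdiag] using this
  refine ⟨⟨φ, P, Q, R, φ_cont, P_cont, Q_cont, R_cont, φ0, hφ, ?_, P_pos, hincφ, φ_taylor, ?_,
    sQ.add sR, ?_⟩⟩
  -- Group property: the trajectory restarted at `φ(t, ξ, τ)` is the shifted trajectory, by
  -- uniqueness; evaluate at time `-τ`.
  · intro t ξ τ
    have h1 : ∀ s, HasDerivAt (fun s => φ (t, ξ, s + τ)) (σ t (φ (t, ξ, s + τ))) s := fun s =>
      (hφ t ξ (s + τ)).comp_add_const s τ
    have h2 := ODE_solution_unique_univ (v := fun _ => σ t) (s := fun _ => Set.univ)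
      (K := ⟨M, hM⟩) (t₀ := 0) (f := fun s => φ (t, φ (t, ξ, τ), s))
      (g := fun s => φ (t, ξ, s + τ)) ?_ (fun s => ⟨hφ _ _ _, trivial⟩) (fun s => ⟨h1 s, trivial⟩)
      (by simp [φ0])
    · simpa [φ0] using congrFun h2 (-τ)
    · intro _
      refine LipschitzOnWith.of_dist_le_mul fun u _ w _ => ?_
      rw [Real.dist_eq, Real.dist_eq]
      exact abs_sub_le_of_abs_deriv_le (dσu t) (fun _ => bσu _) u w
  · have := sC.neg.exp
    simpa only [hP, Real.exp_neg] using this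
  -- `Q` is bounded for bounded `τ`. On the diagonal `R = ½ σ_u σ` grows linearly in `ξ`, because
  -- `σ` and `φ` are Lipschitz in space; compactness is needed only at `ξ = 0`.
  · intro T X
    obtain ⟨K₀, hK₀⟩ : ∃ K₀, ∀ q ∈ Set.Icc (-T) T ×ˢ Set.Icc (-X) X,
        |F (q.1, φ (q.1, 0, q.2))| ≤ K₀ := by
      obtain ⟨K, hK⟩ := (isCompact_Icc.prod isCompact_Icc).exists_bound_of_continuousOn
        (f := fun q : ℝ × ℝ => F (q.1, φ (q.1, 0, q.2)))
        (Continuous.continuousOn (by fun_prop))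
      exact ⟨K, hK⟩
    set E := Real.exp (M * X) with hE
    have hE0 : 0 < E := Real.exp_pos _
    refine ⟨E + (E * (E * M * |X|)) + M * (|K₀| + M * E), by positivity, ?_⟩
    intro t ξ τ ht hτ
    have hX : 0 ≤ X := (abs_nonneg _).trans hτ
    have hEτ : Real.exp (M * |τ|) ≤ E := Real.exp_le_exp.2 (mul_le_mul_of_nonneg_left hτ hM)
    have h0 : 0 ≤ E * (E * M * |X|) := by positivity
    have h0' : 0 ≤ M * (|K₀| + M * E) := by positivity
    refine ⟨by linarith [bP (t, t, ξ, ξ, τ)], by linarith [bP' (t, t, ξ, ξ, τ)], ?_⟩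
    have hq : |Q (t, t, ξ, ξ, τ)| ≤ E * (E * M * |X|) := by
      refine (bQ _).trans ?_
      rw [abs_of_nonneg hX]
      dsimp only
      gcongr
    have hφ0 : |φ (t, ξ, τ) - φ (t, 0, τ)| ≤ E * |ξ| := by
      have := hincφ t t 0 ξ τ
      simp only [sub_zero, sub_self, mul_zero, add_zero] at this
      rw [this, abs_mul, abs_of_pos (P_pos _)]
      exact mul_le_mul_of_nonneg_right ((bP _).trans hEτ) (abs_nonneg _)
    have hFb : |F (t, φ (t, ξ, τ))| ≤ |K₀| + M * E * |ξ| := by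
      have h1 := abs_sub_le_of_abs_deriv_le (dσu t) (fun _ => bσu _) (φ (t, ξ, τ)) (φ (t, 0, τ))
      have h2 := hK₀ (t, τ) ⟨abs_le.1 ht, abs_le.1 hτ⟩
      have h3 := abs_sub_abs_le_abs_sub (F (t, φ (t, ξ, τ))) (F (t, φ (t, 0, τ)))
      have h4 := mul_le_mul_of_nonneg_left hφ0 hM
      have h5 := le_abs_self K₀
      dsimp only at h2
      linarith
    have hr : |R (t, ξ, τ, τ)| ≤ M * (|K₀| + M * E * |ξ|) := by
      rw [hRdiag, abs_mul, abs_mul]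
      have := mul_le_mul (bσu (t, φ (t, ξ, τ))) hFb (abs_nonneg _) hM
      have h1 : |(1 / 2 : ℝ)| = 1 / 2 := by norm_num
      rw [h1]
      nlinarith [mul_nonneg (abs_nonneg (σu (t, φ (t, ξ, τ)))) (abs_nonneg (F (t, φ (t, ξ, τ))))]
    refine (abs_add_le _ _).trans ((add_le_add hq hr).trans ?_)
    have h6 := abs_nonneg ξ
    have h7 : 0 ≤ M * |K₀| * |ξ| := by positivity
    have h8 : 0 ≤ E * (E * M * |X|) * |ξ| := by positivity
    have h9 : 0 ≤ M * (M * E) := by positivity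
    have h10 : 0 ≤ E * |ξ| := by positivity
    nlinarith

/-! ### Successors and telescoping sums along a partition -/

section Succ

variable {P : Finset unitInterval}

theorem le_succIn (P : Finset unitInterval) (s : unitInterval) : s ≤ succIn P s := by
  unfold succIn
  split_ifs with h
  · exact (Finset.mem_filter.1 (Finset.min'_mem _ h)).2.le
  · exact unitInterval.le_one'

theorem succIn_le {s u : unitInterval} (hu : u ∈ P) (h : s < u) : succIn P s ≤ u := by
  have hmem : u ∈ P.filter (fun t => s < t) := Finset.mem_filter.2 ⟨hu, h⟩
  rw [succIn, dif_pos ⟨u, hmem⟩]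
  exact Finset.min'_le _ _ hmem

theorem succIn_mem (h1 : 1 ∈ P) (s : unitInterval) : succIn P s ∈ P := by
  unfold succIn
  split_ifs with h
  · exact (Finset.mem_filter.1 (Finset.min'_mem _ h)).1
  · exact h1

theorem lt_succIn (h1 : 1 ∈ P) {s : unitInterval} (hs : s < 1) : s < succIn P s := by
  have h : (P.filter (fun t => s < t)).Nonempty := ⟨1, Finset.mem_filter.2 ⟨h1, hs⟩⟩
  rw [succIn, dif_pos h]
  exact (Finset.mem_filter.1 (Finset.min'_mem _ h)).2

/-- The largest point `r ≤ t` of `P` has the same predecessors and the same successor as `t`. -/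
theorem exists_last_le (h0 : 0 ∈ P) (t : unitInterval) :
    ∃ r ∈ P, r ≤ t ∧ succIn P r = succIn P t ∧
      P.filter (fun s => s ≤ t) = P.filter (fun s => s ≤ r) := by
  have hne : (P.filter (fun s => s ≤ t)).Nonempty :=
    ⟨0, Finset.mem_filter.2 ⟨h0, unitInterval.nonneg'⟩⟩
  have hr := Finset.mem_filter.1 (Finset.max'_mem _ hne)
  set r := (P.filter (fun s => s ≤ t)).max' hne
  have hle : ∀ s ∈ P, s ≤ t ↔ s ≤ r := fun s hs =>
    ⟨fun h => Finset.le_max' _ _ (Finset.mem_filter.2 ⟨hs, h⟩), fun h => h.trans hr.2⟩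
  have hfil : P.filter (fun s => r < s) = P.filter (fun s => t < s) :=
    Finset.filter_congr fun s hs => by rw [← not_le, ← not_le, hle s hs]
  exact ⟨r, hr.1, hr.2, by simp only [succIn, hfil], Finset.filter_congr fun s hs => hle s hs⟩

/-- Telescoping ends at the successor of `t`, not at `t`, and `t` need not lie in `P`. The
induction, on the number of points up to `t`, replaces `t` by the last point `r ≤ t` and then splits
off the term at `r`. -/
theorem sum_succIn_sub (h0 : 0 ∈ P) (h1 : 1 ∈ P) (F : unitInterval → ℝ) (t : unitInterval) :
    ∑ s ∈ P.filter (fun s => s ≤ t), (F (succIn P s) - F s) = F (succIn P t) - F 0 := by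
  induction hk : (P.filter (fun s => s ≤ t)).card using Nat.strong_induction_on generalizing t with
  | _ k ih =>
  obtain ⟨r, hrP, hrt, hsucc, hfil⟩ := exists_last_le h0 t
  rw [hfil, ← hsucc]
  rw [hfil] at hk
  rcases eq_or_lt_of_le (unitInterval.nonneg' : 0 ≤ r) with rfl | hr
  · have : P.filter (fun s => s ≤ 0) = {0} := by
      ext s
      simp only [Finset.mem_filter, Finset.mem_singleton]
      exact ⟨fun h => le_antisymm h.2 unitInterval.nonneg', fun h => by simp [h, h0]⟩
    rw [this, Finset.sum_singleton]
  · have hne : (P.filter (fun s => s < r)).Nonempty := ⟨0, Finset.mem_filter.2 ⟨h0, hr⟩⟩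
    have hp := Finset.mem_filter.1 (Finset.max'_mem _ hne)
    set p := (P.filter (fun s => s < r)).max' hne
    have hle : ∀ s ∈ P, s < r ↔ s ≤ p := fun s hs =>
      ⟨fun h => Finset.le_max' _ _ (Finset.mem_filter.2 ⟨hs, h⟩), fun h => h.trans_lt hp.2⟩
    have hps : succIn P p = r := by
      refine le_antisymm (succIn_le hrP hp.2) (not_lt.1 fun h => ?_)
      have h2 := (hle _ (succIn_mem h1 p)).1 h
      exact absurd (lt_succIn h1 (hp.2.trans_le unitInterval.le_one')) (not_lt.2 h2)
    have hins : P.filter (fun s => s ≤ r) = insert r (P.filter (fun s => s ≤ p)) := by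
      ext s
      simp only [Finset.mem_filter, Finset.mem_insert]
      constructor
      · rintro ⟨hs, h⟩
        rcases h.eq_or_lt with h | h
        · exact Or.inl h
        · exact Or.inr ⟨hs, (hle s hs).1 h⟩
      · rintro (rfl | ⟨hs, h⟩)
        · exact ⟨hrP, le_rfl⟩
        · exact ⟨hs, h.trans hp.2.le⟩
    have hnot : r ∉ P.filter (fun s => s ≤ p) := fun h =>
      absurd (Finset.mem_filter.1 h).2 (not_le.2 hp.2)
    have hcard := Finset.card_insert_of_notMem hnot
    rw [hins, Finset.sum_insert hnot, ih _ (by rw [hins] at hk; omega) p rfl, hps]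
    ring

theorem filter_le_one (P : Finset unitInterval) : P.filter (fun s => s ≤ 1) = P :=
  Finset.filter_true_of_mem fun _ _ => unitInterval.le_one'

theorem succIn_one (P : Finset unitInterval) : succIn P 1 = 1 :=
  le_antisymm unitInterval.le_one' (le_succIn P 1)

end Succ

/-! ### Weak convergence of discrete weights -/

variable (T : RefiningPartitions)

theorem RefiningPartitions.eventually_dist_succIn_lt {ε : ℝ} (hε : 0 < ε) :
    ∀ᶠ n in atTop, ∀ s, dist (succIn (T.part n) s) s < ε := by
  obtain ⟨N, hN⟩ := T.mesh ε hε
  filter_upwards [eventually_ge_atTop N] with n hn s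
  obtain ⟨r, hrP, hrs, hsucc, -⟩ := exists_last_le (T.zero_mem n) s
  have h1 := hN n hn r hrP
  have h2 : (r : ℝ) ≤ s := hrs
  have h3 : (s : ℝ) ≤ succIn (T.part n) s := le_succIn _ s
  rw [hsucc] at h1
  rw [Subtype.dist_eq, Real.dist_eq, abs_of_nonneg (by linarith)]
  linarith

theorem RefiningPartitions.tendsto_succIn (t : unitInterval) :
    Tendsto (fun n => succIn (T.part n) t) atTop (𝓝 t) :=
  Metric.tendsto_nhds.2 fun _ hε => (T.eventually_dist_succIn_lt hε).mono fun _ h => h t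

theorem RefiningPartitions.eventually_abs_sub_diag_lt {H : unitInterval × unitInterval → ℝ}
    (hH : Continuous H) {ε : ℝ} (hε : 0 < ε) :
    ∀ᶠ n in atTop, ∀ s, |H (s, succIn (T.part n) s) - H (s, s)| < ε := by
  obtain ⟨δ, hδ, h⟩ := Metric.uniformContinuous_iff.1
    (CompactSpace.uniformContinuous_of_continuous hH) ε hε
  filter_upwards [T.eventually_dist_succIn_lt hδ] with n hn s
  rw [← Real.dist_eq]
  exact h (by simpa [Prod.dist_eq, hδ] using hn s)

/-- The weights `w n s` on the points of `T.part n` have bounded total variation, and their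
distribution functions converge pointwise to `ρ`. -/
def ConvWeights (w : ℕ → unitInterval → ℝ) (ρ : unitInterval → ℝ) : Prop :=
  (∃ K, ∀ᶠ n in atTop, ∑ s ∈ T.part n, |w n s| ≤ K) ∧
    ∀ t, Tendsto (fun n => ∑ s ∈ (T.part n).filter (fun s => s ≤ t), w n s) atTop (𝓝 (ρ t))

variable {T}

theorem sum_filter_abs_le (P : Finset unitInterval) (w : unitInterval → ℝ) (t : unitInterval) :
    ∑ s ∈ P.filter (fun s => s ≤ t), |w s| ≤ ∑ s ∈ P, |w s| :=
  Finset.sum_le_sum_of_subset_of_nonneg (Finset.filter_subset _ _) fun _ _ _ => abs_nonneg _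

theorem ConvWeights.add {w w' : ℕ → unitInterval → ℝ} {ρ ρ' : unitInterval → ℝ}
    (h : ConvWeights T w ρ) (h' : ConvWeights T w' ρ') :
    ConvWeights T (fun n s => w n s + w' n s) (fun t => ρ t + ρ' t) := by
  obtain ⟨⟨K, hK⟩, hc⟩ := h
  obtain ⟨⟨K', hK'⟩, hc'⟩ := h'
  refine ⟨⟨K + K', ?_⟩, fun t => by simpa only [Finset.sum_add_distrib] using (hc t).add (hc' t)⟩
  filter_upwards [hK, hK'] with n h1 h2
  refine le_trans (Finset.sum_le_sum fun s _ => abs_add_le _ _) ?_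
  rw [Finset.sum_add_distrib]
  linarith

theorem ConvWeights.neg {w : ℕ → unitInterval → ℝ} {ρ : unitInterval → ℝ}
    (h : ConvWeights T w ρ) : ConvWeights T (fun n s => -w n s) (fun t => -ρ t) := by
  obtain ⟨⟨K, hK⟩, hc⟩ := h
  exact ⟨⟨K, by simpa only [abs_neg] using hK⟩,
    fun t => by simpa only [Finset.sum_neg_distrib] using (hc t).neg⟩

/-- A sum `∑ e` is negligible if `|e| ≤ ε |w|` eventually, for every `ε`. -/
theorem tendsto_sum_zero_of_abs_le {w e : ℕ → unitInterval → ℝ}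
    (hw : ∃ K, ∀ᶠ n in atTop, ∑ s ∈ T.part n, |w n s| ≤ K)
    (he : ∀ ε : ℝ, 0 < ε → ∀ᶠ n in atTop, ∀ s, |e n s| ≤ ε * |w n s|) (t : unitInterval) :
    Tendsto (fun n => ∑ s ∈ (T.part n).filter (fun s => s ≤ t), e n s) atTop (𝓝 0) := by
  obtain ⟨K, hK⟩ := hw
  rw [Metric.tendsto_nhds]
  intro ε hε
  have hpos : 0 < |K| + 1 := by positivity
  filter_upwards [hK, he (ε / (|K| + 1)) (by positivity)] with n h1 h2
  rw [Real.dist_eq, sub_zero]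
  calc |∑ s ∈ (T.part n).filter (fun s => s ≤ t), e n s|
      ≤ ∑ s ∈ (T.part n).filter (fun s => s ≤ t), |e n s| := Finset.abs_sum_le_sum_abs _ _
    _ ≤ ∑ s ∈ T.part n, |e n s| := sum_filter_abs_le _ _ _
    _ ≤ ∑ s ∈ T.part n, ε / (|K| + 1) * |w n s| := Finset.sum_le_sum fun s _ => h2 s
    _ = ε / (|K| + 1) * ∑ s ∈ T.part n, |w n s| := by rw [Finset.mul_sum]
    _ ≤ ε / (|K| + 1) * |K| := by gcongr; exact h1.trans (le_abs_self K)
    _ < ε := by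
      rw [div_mul_eq_mul_div, div_lt_iff₀ hpos]
      nlinarith

/-- The ceiling counts the grid points `j / m` below `s`, so a step function is a constant plus a
combination of indicators of `(j / m, ∞)`. Its sums against weights then involve only distribution
functions. -/
theorem step_eq_sum (g : ℝ → ℝ) {m : ℕ} (hm : 0 < m) {s : ℝ} (hs : s ≤ 1) :
    g (⌈s * m⌉₊ / m) = g 0 + ∑ j ∈ Finset.range m,
      if (j : ℝ) / m < s then g ((j + 1 : ℕ) / m) - g (j / m) else 0 := by
  have hm' : (0 : ℝ) < m := by exact_mod_cast hm
  have hle : ⌈s * m⌉₊ ≤ m := Nat.ceil_le.2 (by nlinarith)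
  have hfil : (Finset.range m).filter (fun j : ℕ => (j : ℝ) / m < s) =
      Finset.range ⌈s * m⌉₊ := by
    ext j
    simp only [Finset.mem_filter, Finset.mem_range, Nat.lt_ceil, div_lt_iff₀ hm']
    exact ⟨fun h => h.2, fun h => ⟨(Nat.lt_ceil.2 h).trans_le hle, h⟩⟩
  rw [← Finset.sum_filter, hfil, Finset.sum_range_sub (fun j : ℕ => g (j / m))]
  simp

/-- A Helly–Bray argument: `G` is uniformly close to a step function, for which the limit follows
from convergence of the distribution functions. Bounded total variation controls the approximation
error. -/
theorem tendsto_sum_mul_zero {w : ℕ → unitInterval → ℝ} (hw : ConvWeights T w fun _ => 0)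
    {G : unitInterval → ℝ} (hG : Continuous G) (t : unitInterval) :
    Tendsto (fun n => ∑ s ∈ (T.part n).filter (fun s => s ≤ t), G s * w n s) atTop (𝓝 0) := by
  obtain ⟨⟨K, hK⟩, hc⟩ := hw
  set g : ℝ → ℝ := fun u => G (Set.projIcc 0 1 zero_le_one u) with hg
  have hgG : ∀ s : unitInterval, g s = G s := fun s => by simp [hg]
  rw [Metric.tendsto_nhds]
  intro ε hε
  have hpos : 0 < |K| + 1 := by positivity
  set η := ε / 2 / (|K| + 1) with hη
  have hη0 : 0 < η := by positivity
  obtain ⟨δ, hδ, hu⟩ := Metric.uniformContinuous_iff.1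
    (CompactSpace.uniformContinuous_of_continuous hG) η hη0
  obtain ⟨m, hm⟩ := exists_nat_one_div_lt hδ
  set N := m + 1 with hN
  have hN0 : (0 : ℝ) < N := by positivity
  set Gm : unitInterval → ℝ := fun s => g (⌈(s : ℝ) * N⌉₊ / N) with hGm
  have happrox : ∀ s, |G s - Gm s| ≤ η := by
    intro s
    have hs0 : (0 : ℝ) ≤ s * N := mul_nonneg s.2.1 hN0.le
    have h1 := Nat.le_ceil ((s : ℝ) * N)
    have h2 := Nat.ceil_lt_add_one hs0
    rw [← hgG, ← Real.dist_eq]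
    refine (hu ?_).le
    refine lt_of_le_of_lt ?_ hm
    refine ((LipschitzWith.projIcc zero_le_one).dist_le_mul (s : ℝ) (⌈(s : ℝ) * N⌉₊ / N)).trans ?_
    rw [NNReal.coe_one, one_mul, Real.dist_eq, abs_sub_comm, abs_of_nonneg]
    · rw [sub_le_iff_le_add, div_le_iff₀ hN0]
      have h3 : ((m : ℝ) + 1) = N := by simp [hN]
      rw [h3, add_mul, one_div, inv_mul_cancel₀ hN0.ne']
      linarith
    · rw [sub_nonneg, le_div_iff₀ hN0]; exact h1
  have hstep : Tendsto (fun n => ∑ s ∈ (T.part n).filter (fun s => s ≤ t), Gm s * w n s)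
      atTop (𝓝 0) := by
    have hj : ∀ j : ℕ, Tendsto (fun n => ∑ s ∈ (T.part n).filter (fun s => s ≤ t),
        (if (j : ℝ) / N < s then g ((j + 1 : ℕ) / N) - g (j / N) else 0) * w n s)
        atTop (𝓝 0) := by
      intro j
      by_cases hjN : (j : ℝ) / N ≤ 1
      · set c : unitInterval := ⟨j / N, by positivity, hjN⟩ with hcdef
        have := ((hc t).sub (hc (min t c))).const_mul (g ((j + 1 : ℕ) / N) - g (j / N))
        rw [sub_zero, mul_zero] at this
        refine this.congr fun n => ?_
        have hsplit : (T.part n).filter (fun s => s ≤ min t c) =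
            ((T.part n).filter (fun s => s ≤ t)).filter (fun s => s ≤ c) := by
          rw [Finset.filter_filter]
          exact Finset.filter_congr fun s _ => le_min_iff
        rw [hsplit, ← Finset.sum_filter_add_sum_filter_not
          ((T.part n).filter (fun s => s ≤ t)) (fun s => s ≤ c) (w n), add_sub_cancel_left,
          Finset.mul_sum, Finset.sum_filter]
        refine Finset.sum_congr rfl fun s _ => ?_
        have : (j : ℝ) / N < s ↔ ¬ s ≤ c := by rw [not_le]; rfl
        simp only [this]
        split_ifs <;> simp
      · refine tendsto_const_nhds.congr fun n => ?_
        symm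
        refine Finset.sum_eq_zero fun s _ => ?_
        rw [if_neg, zero_mul]
        exact fun h => hjN (h.le.trans s.2.2)
    have := ((hc t).const_mul (g 0)).add
      (tendsto_finsetSum (Finset.range N) fun j _ => hj j)
    rw [mul_zero, Finset.sum_const_zero, add_zero] at this
    refine this.congr fun n => ?_
    rw [Finset.sum_comm, Finset.mul_sum, ← Finset.sum_add_distrib]
    refine Finset.sum_congr rfl fun s _ => ?_
    simp only [hGm]
    rw [step_eq_sum g (Nat.succ_pos m) s.2.2, add_mul, Finset.sum_mul]
  filter_upwards [hK, Metric.tendsto_nhds.1 hstep (ε / 2) (by positivity)] with n h1 h2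
  rw [Real.dist_eq, sub_zero] at h2 ⊢
  have h3 : |∑ s ∈ (T.part n).filter (fun s => s ≤ t), (G s - Gm s) * w n s| ≤ ε / 2 := by
    calc |∑ s ∈ (T.part n).filter (fun s => s ≤ t), (G s - Gm s) * w n s|
        ≤ ∑ s ∈ (T.part n).filter (fun s => s ≤ t), |(G s - Gm s) * w n s| :=
          Finset.abs_sum_le_sum_abs _ _
      _ ≤ ∑ s ∈ T.part n, |(G s - Gm s) * w n s| := sum_filter_abs_le _ _ _
      _ ≤ ∑ s ∈ T.part n, η * |w n s| := Finset.sum_le_sum fun s _ => by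
          rw [abs_mul]; exact mul_le_mul_of_nonneg_right (happrox s) (abs_nonneg _)
      _ = η * ∑ s ∈ T.part n, |w n s| := by rw [Finset.mul_sum]
      _ ≤ η * (|K| + 1) := by gcongr; linarith [le_abs_self K]
      _ = ε / 2 := by rw [hη]; field_simp
  have h4 : ∑ s ∈ (T.part n).filter (fun s => s ≤ t), G s * w n s =
      ∑ s ∈ (T.part n).filter (fun s => s ≤ t), (G s - Gm s) * w n s +
      ∑ s ∈ (T.part n).filter (fun s => s ≤ t), Gm s * w n s := by
    rw [← Finset.sum_add_distrib]
    exact Finset.sum_congr rfl fun s _ => by ring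
  rw [h4]
  exact (abs_add_le _ _).trans_lt (by linarith)

/-! ### Weights with continuous densities -/

theorem continuous_comp_projIcc {g : unitInterval → ℝ} (hg : Continuous g) :
    Continuous fun u : ℝ => g (Set.projIcc 0 1 zero_le_one u) :=
  hg.comp continuous_projIcc

theorem timeIntegral_sub {g : unitInterval → ℝ} (hg : Continuous g) (s t : unitInterval) :
    timeIntegral g t - timeIntegral g s =
      ∫ u in (s : ℝ)..t, g (Set.projIcc 0 1 zero_le_one u) :=
  intervalIntegral.integral_interval_sub_left
    ((continuous_comp_projIcc hg).intervalIntegrable _ _)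
    ((continuous_comp_projIcc hg).intervalIntegrable _ _)

theorem timeIntegral_zero (g : unitInterval → ℝ) : timeIntegral g 0 = 0 := by
  simp [timeIntegral]

theorem timeIntegral_const (c : ℝ) (t : unitInterval) : timeIntegral (fun _ => c) t = c * t := by
  simp [timeIntegral, mul_comm]

theorem timeIntegral_add {f g : unitInterval → ℝ} (hf : Continuous f) (hg : Continuous g)
    (t : unitInterval) :
    timeIntegral (fun s => f s + g s) t = timeIntegral f t + timeIntegral g t :=
  intervalIntegral.integral_add ((continuous_comp_projIcc hf).intervalIntegrable _ _)
    ((continuous_comp_projIcc hg).intervalIntegrable _ _)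

theorem timeIntegral_neg (f : unitInterval → ℝ) (t : unitInterval) :
    timeIntegral (fun s => -f s) t = -timeIntegral f t :=
  intervalIntegral.integral_neg

theorem continuous_timeIntegral {g : unitInterval → ℝ} (hg : Continuous g) :
    Continuous (timeIntegral g) :=
  (intervalIntegral.continuous_primitive
    (fun _ _ => (continuous_comp_projIcc hg).intervalIntegrable _ _) 0).comp continuous_subtype_val

theorem exists_abs_le {X : Type*} [TopologicalSpace X] [CompactSpace X] {g : X → ℝ}
    (hg : Continuous g) : ∃ M, 0 ≤ M ∧ ∀ s, |g s| ≤ M := by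
  obtain ⟨M, hM⟩ := isCompact_univ.exists_bound_of_continuousOn hg.continuousOn
  exact ⟨|M|, abs_nonneg _, fun s => (hM s trivial).trans (le_abs_self M)⟩

theorem abs_timeIntegral_sub_le {g : unitInterval → ℝ} (hg : Continuous g) {M : ℝ}
    {s t : unitInterval} (hst : s ≤ t) (hM : ∀ u, s ≤ u → u ≤ t → |g u| ≤ M) :
    |timeIntegral g t - timeIntegral g s| ≤ M * (t - s) := by
  have hst' : (s : ℝ) ≤ t := hst
  rw [timeIntegral_sub hg]
  have := intervalIntegral.norm_integral_le_of_norm_le_const (a := (s : ℝ)) (b := t) (C := M)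
    (f := fun u => g (Set.projIcc 0 1 zero_le_one u)) fun u hu => ?_
  · simpa [abs_of_nonneg (sub_nonneg.2 hst')] using this
  · rw [Set.uIoc_of_le hst'] at hu
    have hu01 : u ∈ Set.Icc (0 : ℝ) 1 := ⟨s.2.1.trans hu.1.le, hu.2.trans t.2.2⟩
    rw [Set.projIcc_of_mem _ hu01]
    exact hM _ hu.1.le hu.2

variable {T : RefiningPartitions}

theorem sum_abs_succIn_sub_le {P : Finset unitInterval} (h0 : 0 ∈ P) (h1 : 1 ∈ P)
    {F : unitInterval → ℝ} {M : ℝ} (hF : ∀ s, |F (succIn P s) - F s| ≤ M * (succIn P s - s)) :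
    ∑ s ∈ P, |F (succIn P s) - F s| ≤ M := by
  have h := sum_succIn_sub h0 h1 (fun s => M * (s : ℝ)) 1
  rw [filter_le_one, succIn_one] at h
  calc ∑ s ∈ P, |F (succIn P s) - F s| ≤ ∑ s ∈ P, (M * (succIn P s : ℝ) - M * s) :=
        Finset.sum_le_sum fun s _ => (hF s).trans_eq (mul_sub _ _ _)
    _ = M := by rw [h]; simp

theorem convWeights_timeIntegral (T : RefiningPartitions) {g : unitInterval → ℝ}
    (hg : Continuous g) :
    ConvWeights T (fun n s => timeIntegral g (succIn (T.part n) s) - timeIntegral g s)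
      (timeIntegral g) := by
  obtain ⟨M, -, hM⟩ := exists_abs_le hg
  refine ⟨⟨M, Eventually.of_forall fun n => sum_abs_succIn_sub_le (T.zero_mem n) (T.one_mem n)
    fun s => abs_timeIntegral_sub_le hg (le_succIn _ s) fun u _ _ => hM u⟩, fun t => ?_⟩
  simp only [fun n => sum_succIn_sub (T.zero_mem n) (T.one_mem n), timeIntegral_zero, sub_zero]
  exact ((continuous_timeIntegral hg).tendsto t).comp (T.tendsto_succIn t)

theorem convWeights_time (T : RefiningPartitions) :
    ConvWeights T (fun n s => (succIn (T.part n) s : ℝ) - s) (timeIntegral fun _ => 1) := by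
  have := convWeights_timeIntegral T (g := fun _ => 1) continuous_const
  simpa only [timeIntegral_const, one_mul] using this

theorem convWeights_sq {x : C(unitInterval, ℝ)} (hx : HasQuadVar T x (fun t => (t : ℝ))) :
    ConvWeights T (fun n s => (x (succIn (T.part n) s) - x s) ^ 2) (timeIntegral fun _ => 1) := by
  simp only [ConvWeights, timeIntegral_const, one_mul]
  -- The weights are nonnegative, so their total variation is the square sum at time `1`. It tends
  -- to `1` and is eventually below `2`.
  refine ⟨⟨2, ?_⟩, hx⟩
  filter_upwards [(hx 1).eventually (gt_mem_nhds (show ((1 : unitInterval) : ℝ) < 2 by norm_num))]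
    with n hn
  rw [squareSum, filter_le_one] at hn
  simpa only [abs_sq] using hn.le

/-- On each partition interval `G(s) ∫ g = ∫ G g + ∫ (G(s) - G(u)) g(u) du`. The first parts
telescope, and by uniform continuity of `G` the second are at most `ε` times the length of the
interval. -/
theorem tendsto_sum_mul_timeIntegral (T : RefiningPartitions) {G g : unitInterval → ℝ}
    (hG : Continuous G) (hg : Continuous g) (t : unitInterval) :
    Tendsto (fun n => ∑ s ∈ (T.part n).filter (fun s => s ≤ t),
      G s * (timeIntegral g (succIn (T.part n) s) - timeIntegral g s)) atTop
      (𝓝 (timeIntegral (fun s => G s * g s) t)) := by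
  obtain ⟨M, hM0, hM⟩ := exists_abs_le hg
  have hsmall := tendsto_sum_zero_of_abs_le (T := T)
    (w := fun n s => (succIn (T.part n) s : ℝ) - s)
    (e := fun n s => timeIntegral (fun u => (G s - G u) * g u) (succIn (T.part n) s) -
      timeIntegral (fun u => (G s - G u) * g u) s) (convWeights_time T).1 ?_ t
  · have hGg : Continuous fun u => G u * g u := hG.mul hg
    have h := ((convWeights_timeIntegral T hGg).2 t).add hsmall
    rw [add_zero] at h
    refine h.congr fun n => ?_
    rw [← Finset.sum_add_distrib]
    refine Finset.sum_congr rfl fun s _ => ?_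
    have hsg : Continuous fun u => (G s - G u) * g u := by fun_prop
    have hGg' := continuous_comp_projIcc hGg
    have hsg' := continuous_comp_projIcc hsg
    dsimp only
    rw [timeIntegral_sub hg, timeIntegral_sub hGg, timeIntegral_sub hsg,
      ← intervalIntegral.integral_add (hGg'.intervalIntegrable _ _)
        (hsg'.intervalIntegrable _ _), ← intervalIntegral.integral_const_mul]
    exact intervalIntegral.integral_congr fun u _ => by ring
  · intro ε hε
    obtain ⟨δ, hδ, h⟩ := Metric.uniformContinuous_iff.1
      (CompactSpace.uniformContinuous_of_continuous hG) (ε / (M + 1)) (by positivity)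
    filter_upwards [T.eventually_dist_succIn_lt hδ] with n hn s
    have hle : (s : ℝ) ≤ succIn (T.part n) s := le_succIn _ s
    rw [abs_of_nonneg (sub_nonneg.2 hle)]
    refine abs_timeIntegral_sub_le (by fun_prop) (le_succIn _ s) fun u hsu hus => ?_
    have hsu' : (s : ℝ) ≤ u := hsu
    have hus' : (u : ℝ) ≤ succIn (T.part n) s := hus
    have hd : |G s - G u| < ε / (M + 1) := by
      rw [← Real.dist_eq]
      refine h ?_
      have := hn s
      rw [Subtype.dist_eq, Real.dist_eq] at this ⊢
      rw [abs_of_nonneg (by linarith)] at this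
      rw [abs_sub_comm, abs_of_nonneg (by linarith)]
      linarith
    rw [abs_mul]
    calc |G s - G u| * |g u| ≤ ε / (M + 1) * (M + 1) :=
          mul_le_mul hd.le ((hM u).trans (by linarith)) (abs_nonneg _) (by positivity)
      _ = ε := by field_simp

/-- Continuous densities may be inserted into convergent weights. -/
theorem ConvWeights.mul_left {w : ℕ → unitInterval → ℝ} {g : unitInterval → ℝ}
    (hw : ConvWeights T w (timeIntegral g)) (hg : Continuous g)
    {H : unitInterval × unitInterval → ℝ} (hH : Continuous H) :
    ConvWeights T (fun n s => H (s, succIn (T.part n) s) * w n s)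
      (timeIntegral fun s => H (s, s) * g s) := by
  obtain ⟨M, hM0, hM⟩ := exists_abs_le hH
  have hG : Continuous fun s => H (s, s) := by fun_prop
  constructor
  · obtain ⟨K, hK⟩ := hw.1
    refine ⟨M * K, hK.mono fun n hn => ?_⟩
    calc ∑ s ∈ T.part n, |H (s, succIn (T.part n) s) * w n s|
        ≤ ∑ s ∈ T.part n, M * |w n s| := Finset.sum_le_sum fun s _ => by
          rw [abs_mul]; exact mul_le_mul_of_nonneg_right (hM _) (abs_nonneg _)
      _ ≤ M * K := by rw [← Finset.mul_sum]; exact mul_le_mul_of_nonneg_left hn hM0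
  · intro t
    -- Subtracting the increments of `∫ g` leaves weights with limit zero. The density is evaluated
    -- first on the diagonal; passing from `H(s, s)` to `H(s, s')` costs a uniformly small multiple
    -- of the total variation.
    have hz : ConvWeights T (fun n s => w n s +
        -(timeIntegral g (succIn (T.part n) s) - timeIntegral g s)) fun _ => 0 := by
      simpa only [add_neg_cancel] using hw.add (convWeights_timeIntegral T hg).neg
    have h1 := tendsto_sum_mul_zero hz hG t
    have h2 := tendsto_sum_mul_timeIntegral T hG hg t
    have h3 := tendsto_sum_zero_of_abs_le (T := T) (w := w)
      (e := fun n s => (H (s, succIn (T.part n) s) - H (s, s)) * w n s) hw.1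
      (fun ε hε => (T.eventually_abs_sub_diag_lt hH hε).mono fun n hn s => by
        rw [abs_mul]; exact mul_le_mul_of_nonneg_right (hn s).le (abs_nonneg _)) t
    have h := (h1.add h2).add h3
    rw [zero_add, add_zero] at h
    refine h.congr fun n => ?_
    rw [← Finset.sum_add_distrib, ← Finset.sum_add_distrib]
    exact Finset.sum_congr rfl fun s _ => by ring

/-! ### Admissible integrands and bounded variation of the residuals -/

theorem abs_taylor_le {h h' h'' : ℝ → ℝ} {I : Set ℝ} (hI : Convex ℝ I) {K : ℝ}
    (h1 : ∀ ξ ∈ I, HasDerivAt h (h' ξ) ξ) (h2 : ∀ ξ ∈ I, HasDerivAt h' (h'' ξ) ξ)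
    (hK : ∀ ξ ∈ I, |h'' ξ| ≤ K) {x y : ℝ} (hx : x ∈ I) (hy : y ∈ I) :
    |h y - h x - h' x * (y - x)| ≤ K * (y - x) ^ 2 := by
  have hK0 : 0 ≤ K := (abs_nonneg _).trans (hK x hx)
  have hlip : ∀ ξ ∈ I, |h' ξ - h' x| ≤ K * |ξ - x| := fun ξ hξ =>
    hI.norm_image_sub_le_of_norm_hasDerivWithin_le (fun u hu => (h2 u hu).hasDerivWithinAt) hK hx hξ
  have hsub : Set.uIcc x y ⊆ I := by
    rw [← segment_eq_uIcc]; exact hI.segment_subset hx hy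
  have := (convex_uIcc x y).norm_image_sub_le_of_norm_hasDerivWithin_le
    (f := fun ξ => h ξ - h' x * ξ) (f' := fun ξ => h' ξ - h' x) (C := K * |y - x|)
    (fun u hu => ((h1 u (hsub hu)).sub (by
      simpa using (hasDerivAt_id u).const_mul (h' x))).hasDerivWithinAt)
    (fun u hu => (hlip u (hsub hu)).trans
      (mul_le_mul_of_nonneg_left (Set.abs_sub_left_of_mem_uIcc hu) hK0))
    Set.left_mem_uIcc Set.right_mem_uIcc
  rw [Real.norm_eq_abs, Real.norm_eq_abs, mul_assoc, ← sq, sq_abs] at this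
  convert this using 2
  ring

/-- With a Jordan decomposition `a = p - q`, each term is at most the increment of the monotone
function `p + q`, and these increments telescope. -/
theorem exists_sum_abs_sub_le_of_boundedVariationOn {a : unitInterval → ℝ}
    (ha : BoundedVariationOn a Set.univ) :
    ∃ K, ∀ P : Finset unitInterval, 0 ∈ P → 1 ∈ P → ∑ s ∈ P, |a (succIn P s) - a s| ≤ K := by
  obtain ⟨p, q, hp, hq, rfl⟩ := ha.locallyBoundedVariationOn.exists_monotoneOn_sub_monotoneOn
  rw [monotoneOn_univ] at hp hq
  refine ⟨(p 1 + q 1) - (p 0 + q 0), fun P h0 h1 => ?_⟩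
  have h := sum_succIn_sub h0 h1 (fun s => p s + q s) 1
  rw [filter_le_one, succIn_one] at h
  rw [← h]
  refine Finset.sum_le_sum fun s _ => ?_
  have h2 := hp (le_succIn P s)
  have h3 := hq (le_succIn P s)
  simp only [Pi.sub_apply]
  rw [abs_le]
  constructor <;> linarith

variable {T : RefiningPartitions}

theorem RefiningPartitions.eventually_dist_comp_succIn_lt (T : RefiningPartitions) {E : Type*}
    [PseudoMetricSpace E] {γ : unitInterval → E} (hγ : Continuous γ) {ε : ℝ} (hε : 0 < ε) :
    ∀ᶠ n in atTop, ∀ s, dist (γ (succIn (T.part n) s)) (γ s) < ε := by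
  obtain ⟨δ, hδ, h⟩ := Metric.uniformContinuous_iff.1
    (CompactSpace.uniformContinuous_of_continuous hγ) ε hε
  exact (T.eventually_dist_succIn_lt hδ).mono fun n hn s => h (hn s)

/-- Along a path with quadratic variation `t`, an admissible integrand `η` is the coefficient in a
first order expansion of a continuous function, up to an error of bounded total variation. -/
theorem IsAdmissibleIntegrand.exists_sum_abs_le {x : C(unitInterval, ℝ)} {η : unitInterval → ℝ}
    (hη : IsAdmissibleIntegrand x η) (hx : HasQuadVar T x (fun t => (t : ℝ))) :
    ∃ g : unitInterval → ℝ, Continuous g ∧ ∃ K, ∀ᶠ n in atTop, ∑ s ∈ T.part n,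
      |g (succIn (T.part n) s) - g s - η s * (x (succIn (T.part n) s) - x s)| ≤ K := by
  obtain ⟨d, A, U, f, hA, hBV, hU, hAU, hf, hf2, hf2c, hη⟩ := hη
  set γ : unitInterval → (Fin d → ℝ) × ℝ := fun t => (A t, x t) with hγ
  have hγc : Continuous γ := by fun_prop
  have hgc : Continuous fun t => f (γ t) := hf.continuousOn.comp_continuous hγc hAU
  have hK0 : IsCompact (Set.range γ) := isCompact_range hγc
  -- A compact neighbourhood of the path inside `U` bounds the derivatives. For fine partitions
  -- consecutive points share a `δ`-ball, whose convexity permits mean value estimates.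
  obtain ⟨δ, hδ, hδU⟩ := hK0.exists_cthickening_subset_open hU (Set.range_subset_iff.2 hAU)
  have hcomp : IsCompact (Metric.cthickening δ (Set.range γ)) := hK0.cthickening
  obtain ⟨L, hL⟩ := hcomp.exists_bound_of_continuousOn
    ((hf.continuousOn_fderiv_of_isOpen hU le_rfl).mono hδU)
  obtain ⟨K₂, hK₂⟩ := hcomp.exists_bound_of_continuousOn (hf2c.mono hδU)
  choose V hV using fun i => exists_sum_abs_sub_le_of_boundedVariationOn (hBV i)
  refine ⟨fun t => f (γ t), hgc, |L| * ∑ i, V i + |K₂| * 2, ?_⟩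
  have hsq : ∀ᶠ n in atTop, ∑ s ∈ T.part n, (x (succIn (T.part n) s) - x s) ^ 2 < 2 := by
    filter_upwards [(hx 1).eventually
      (gt_mem_nhds (show ((1 : unitInterval) : ℝ) < 2 by norm_num))] with n hn
    rwa [squareSum, filter_le_one] at hn
  filter_upwards [T.eventually_dist_comp_succIn_lt hγc hδ, hsq] with n hn hsqn
  have hpt : ∀ s, |f (γ (succIn (T.part n) s)) - f (γ s) -
      η s * (x (succIn (T.part n) s) - x s)| ≤
      |L| * ∑ i, |A (succIn (T.part n) s) i - A s i| +
        |K₂| * (x (succIn (T.part n) s) - x s) ^ 2 := by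
    intro s
    set s' := succIn (T.part n) s
    have hball : Metric.closedBall (γ s) δ ⊆ Metric.cthickening δ (Set.range γ) :=
      Metric.closedBall_subset_cthickening (Set.mem_range_self s) δ
    have hd : dist (A s') (A s) < δ ∧ dist (x s') (x s) < δ := by
      have := hn s
      rwa [Prod.dist_eq, max_lt_iff] at this
    -- The increment is split in two: the change of `A` is controlled by bounded variation, the
    -- change of `x` by Taylor's formula and the square sums.
    have h1 : |f (A s', x s') - f (A s, x s')| ≤ |L| * ∑ i, |A s' i - A s i| := by
      have := (convex_closedBall (γ s) δ).norm_image_sub_le_of_norm_fderiv_le (f := f) (C := |L|)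
        (x := (A s, x s')) (y := (A s', x s'))
        (fun p hp => (hf.differentiableOn one_ne_zero).differentiableAt
          (hU.mem_nhds (hδU (hball hp))))
        (fun p hp => (hL p (hball hp)).trans (le_abs_self L))
        (by rw [Metric.mem_closedBall, Prod.dist_eq]; exact max_le ((dist_self (A s)).trans_le hδ.le) hd.2.le)
        (by rw [Metric.mem_closedBall, Prod.dist_eq]; exact max_le hd.1.le hd.2.le)
      refine this.trans (mul_le_mul_of_nonneg_left ?_ (abs_nonneg _))
      have h0 : 0 ≤ ∑ i, |A s' i - A s i| := Finset.sum_nonneg fun _ _ => abs_nonneg _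
      rw [Prod.mk_sub_mk, sub_self, Prod.norm_mk, norm_zero, max_eq_left (norm_nonneg _),
        pi_norm_le_iff_of_nonneg h0]
      intro i
      exact Finset.single_le_sum (f := fun i => |A s' i - A s i|) (fun _ _ => abs_nonneg _)
        (Finset.mem_univ i)
    have hUs : IsOpen {ξ | (A s, ξ) ∈ U} := hU.preimage (by fun_prop)
    have hmem : ∀ ξ ∈ Metric.closedBall (x s) δ, (A s, ξ) ∈ Metric.cthickening δ (Set.range γ) := by
      intro ξ hξ
      refine hball ?_
      rw [Metric.mem_closedBall, Prod.dist_eq]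
      exact max_le ((dist_self (A s)).trans_le hδ.le) hξ
    have h2 : |f (A s, x s') - f (A s, x s) - η s * (x s' - x s)| ≤ |K₂| * (x s' - x s) ^ 2 := by
      rw [hη s]
      refine abs_taylor_le (h := fun ξ => f (A s, ξ)) (convex_closedBall (x s) δ)
        (h' := deriv fun ξ => f (A s, ξ)) (h'' := iteratedDeriv 2 fun ξ => f (A s, ξ))
        (fun ξ hξ => ?_) (fun ξ hξ => ?_) (fun ξ hξ => ?_) (Metric.mem_closedBall_self hδ.le) hd.2.le
      · exact ((hf2 (A s)).contDiffAt (hUs.mem_nhds (hδU (hmem ξ hξ)))).differentiableAt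
          two_ne_zero |>.hasDerivAt
      · have hd2 := (hf2 (A s)).deriv_of_isOpen (m := 1) hUs (by norm_num)
        have := (hd2.differentiableOn one_ne_zero).differentiableAt
          (hUs.mem_nhds (hδU (hmem ξ hξ))) |>.hasDerivAt
        rwa [iteratedDeriv_succ, iteratedDeriv_one]
      · exact (hK₂ _ (hmem ξ hξ)).trans (le_abs_self K₂)
    have := abs_add_le (f (A s', x s') - f (A s, x s'))
      (f (A s, x s') - f (A s, x s) - η s * (x s' - x s))
    rw [show f (A s', x s') - f (A s, x s') + (f (A s, x s') - f (A s, x s) - η s * (x s' - x s)) =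
      f (γ s') - f (γ s) - η s * (x s' - x s) by simp only [hγ]; ring] at this
    linarith
  calc ∑ s ∈ T.part n, |f (γ (succIn (T.part n) s)) - f (γ s) -
        η s * (x (succIn (T.part n) s) - x s)|
      ≤ ∑ s ∈ T.part n, (|L| * ∑ i, |A (succIn (T.part n) s) i - A s i| +
        |K₂| * (x (succIn (T.part n) s) - x s) ^ 2) := Finset.sum_le_sum fun s _ => hpt s
    _ = |L| * ∑ i, ∑ s ∈ T.part n, |A (succIn (T.part n) s) i - A s i| +
        |K₂| * ∑ s ∈ T.part n, (x (succIn (T.part n) s) - x s) ^ 2 := by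
      rw [Finset.sum_add_distrib, ← Finset.mul_sum, ← Finset.mul_sum, Finset.sum_comm]
    _ ≤ |L| * ∑ i, V i + |K₂| * 2 := by
      gcongr with i
      exact hV i _ (T.zero_mem n) (T.one_mem n)

/-- Lower semicontinuity of total variation: for fixed `m`, the increments of the `n`th distribution
function over the intervals of `T.part m` are sums over disjoint blocks, hence together at most `∑
|e n s|`. Then `n → ∞`. -/
theorem sum_abs_sub_le_of_tendsto {e : ℕ → unitInterval → ℝ} {h : unitInterval → ℝ} {K : ℝ}
    (hK : ∀ᶠ n in atTop, ∑ s ∈ T.part n, |e n s| ≤ K)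
    (hh : ∀ t, Tendsto (fun n => ∑ s ∈ (T.part n).filter (fun s => s ≤ t), e n s) atTop (𝓝 (h t)))
    (m : ℕ) : ∑ s ∈ T.part m, |h (succIn (T.part m) s) - h s| ≤ K := by
  refine le_of_tendsto (tendsto_finsetSum (T.part m) fun s _ =>
    ((hh (succIn (T.part m) s)).sub (hh s)).abs) ?_
  filter_upwards [hK] with n hn
  set v : unitInterval → ℝ := fun t => ∑ s ∈ (T.part n).filter (fun s => s ≤ t), |e n s| with hv
  have htel := sum_succIn_sub (T.zero_mem m) (T.one_mem m) v 1
  rw [filter_le_one, succIn_one] at htel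
  have hv0 : 0 ≤ v 0 := Finset.sum_nonneg fun _ _ => abs_nonneg _
  have hv1 : v 1 ≤ K := by rw [hv]; simp only [filter_le_one]; exact hn
  refine le_trans (Finset.sum_le_sum fun s _ => ?_) (htel.trans_le (by linarith))
  have hsub : (T.part n).filter (fun u => u ≤ s) ⊆
      (T.part n).filter (fun u => u ≤ succIn (T.part m) s) :=
    Finset.monotone_filter_right _ fun u _ hu => hu.trans (le_succIn _ s)
  simp only [hv]
  rw [← Finset.sum_sdiff hsub, ← Finset.sum_sdiff hsub, add_sub_cancel_right,
    add_sub_cancel_right]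
  exact Finset.abs_sum_le_sum_abs _ _

theorem HasFollmerIntegral.zero_eq {x : C(unitInterval, ℝ)} {η : unitInterval → ℝ} {v : ℝ}
    (h : HasFollmerIntegral T x η 0 v) : v = 0 := by
  refine tendsto_nhds_unique h ?_
  have hx : Tendsto (fun n => η 0 * (x (succIn (T.part n) 0) - x 0)) atTop (𝓝 0) := by
    have := (((x.continuous.tendsto 0).comp (T.tendsto_succIn 0)).sub_const (x 0)).const_mul (η 0)
    simpa using this
  refine hx.congr fun n => ?_
  have : (T.part n).filter (fun s => s ≤ 0) = {0} := by
    ext s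
    simp only [Finset.mem_filter, Finset.mem_singleton]
    exact ⟨fun h => le_antisymm h.2 unitInterval.nonneg', fun h => by simp [h, T.zero_mem n]⟩
  rw [riemannSum, this, Finset.sum_singleton]

/-- The distribution functions converge by the equation itself; the issue is bounded total
variation. Take the continuous `g` supplied by admissibility. Then `h = g - g(0) - J` is a limit of
sums of `Δg - σ Δx`, hence has bounded variation along the partitions, and `Δz - σ Δx = (Δg - σ Δx)
- Δh + Δ∫b`. -/
theorem IsItoSolution.convWeights {x z : C(unitInterval, ℝ)} {σ : unitInterval → ℝ → ℝ}
    {b : unitInterval → ℝ} {z₀ : ℝ} (hz : IsItoSolution T x σ (fun t _ => b t) z₀ z)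
    (hb : Continuous b) (hx : HasQuadVar T x (fun t => (t : ℝ))) :
    ConvWeights T (fun n s => z (succIn (T.part n) s) - z s -
      σ s (z s) * (x (succIn (T.part n) s) - x s)) (timeIntegral b) := by
  obtain ⟨hadm, J, hJ, hzJ⟩ := hz
  obtain ⟨g, hg, K, hK⟩ := hadm.exists_sum_abs_le hx
  have hsum : ∀ F : unitInterval → ℝ, Continuous F → ∀ t, Tendsto (fun n =>
      ∑ s ∈ (T.part n).filter (fun s => s ≤ t), (F (succIn (T.part n) s) - F s -
        σ s (z s) * (x (succIn (T.part n) s) - x s))) atTop (𝓝 (F t - F 0 - J t)) := by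
    intro F hF t
    refine ((((hF.tendsto t).comp (T.tendsto_succIn t)).sub_const (F 0)).sub (hJ t)).congr
      fun n => ?_
    rw [Finset.sum_sub_distrib, sum_succIn_sub (T.zero_mem n) (T.one_mem n)]
    rfl
  have hvar := sum_abs_sub_le_of_tendsto hK (hsum g hg)
  obtain ⟨M, hM⟩ := (convWeights_timeIntegral T hb).1
  refine ⟨⟨K + K + M, ?_⟩, fun t => ?_⟩
  · filter_upwards [hK, hM] with n h1 h2
    have h3 := hvar n
    refine le_trans (Finset.sum_le_sum (g := fun s => |g (succIn (T.part n) s) - g s -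
        σ s (z s) * (x (succIn (T.part n) s) - x s)| +
        |g (succIn (T.part n) s) - g 0 - J (succIn (T.part n) s) - (g s - g 0 - J s)| +
        |timeIntegral b (succIn (T.part n) s) - timeIntegral b s|) fun s _ => ?_) ?_
    · have h4 : z (succIn (T.part n) s) - z s = (g (succIn (T.part n) s) - g s) -
          (g (succIn (T.part n) s) - g 0 - J (succIn (T.part n) s) - (g s - g 0 - J s)) +
          (timeIntegral b (succIn (T.part n) s) - timeIntegral b s) := by
        rw [hzJ, hzJ s]; ring
      rw [h4]
      generalize g (succIn (T.part n) s) - g 0 - J (succIn (T.part n) s) - (g s - g 0 - J s) = p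
      generalize timeIntegral b (succIn (T.part n) s) - timeIntegral b s = q
      generalize g (succIn (T.part n) s) - g s = r
      generalize σ s (z s) * (x (succIn (T.part n) s) - x s) = w
      rw [show r - p + q - w = (r - w) + -p + q by ring]
      refine (abs_add_le _ _).trans (add_le_add_left ((abs_add_le _ _).trans ?_) _)
      rw [abs_neg]
    · rw [Finset.sum_add_distrib, Finset.sum_add_distrib]
      linarith
  · have h := hsum z z.continuous t
    have hJ0 := (hJ 0).zero_eq
    have h5 : z t - z 0 - J t = timeIntegral b t := by
      rw [hzJ t, hzJ 0, hJ0, timeIntegral_zero]; ring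
    rwa [h5] at h

/-! ### Itô's formula along the flow -/

/-- Carathéodory's criterion for differentiability. It turns the increment formulas for the flow
into derivatives. -/
theorem hasFDerivAt_of_increment {E : Type*} [NormedAddCommGroup E] [NormedSpace ℝ E] {F : E → ℝ}
    {L : E → E →L[ℝ] ℝ} {p : E} (hL : ContinuousAt L p) (h : ∀ q, F q - F p = L q (q - p)) :
    HasFDerivAt F (L p) p := by
  rw [hasFDerivAt_iff_isLittleO, Asymptotics.isLittleO_iff]
  intro c hc
  filter_upwards [Metric.continuousAt_iff'.1 hL c hc] with q hq
  rw [h q, ← sub_apply]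
  refine (ContinuousLinearMap.le_opNorm _ _).trans ?_
  rw [← dist_eq_norm]
  exact mul_le_mul_of_nonneg_right hq.le (norm_nonneg _)

theorem boundedVariationOn_of_abs_sub_le {B : unitInterval → ℝ} {M : ℝ} (hM : 0 ≤ M)
    (hB : ∀ s t, s ≤ t → |B t - B s| ≤ M * (t - s)) : BoundedVariationOn B Set.univ := by
  have hlip : LipschitzWith ⟨M, hM⟩ B := by
    refine LipschitzWith.of_dist_le_mul fun s t => ?_
    rw [Subtype.dist_eq, Real.dist_eq, Real.dist_eq]
    change _ ≤ M * _
    rcases le_total s t with h | h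
    · have h' : (s : ℝ) ≤ t := h
      rw [abs_sub_comm, abs_sub_comm (s : ℝ), abs_of_nonneg (sub_nonneg.2 h')]
      exact hB s t h
    · have h' : (t : ℝ) ≤ s := h
      rw [abs_of_nonneg (sub_nonneg.2 h')]
      exact hB t s h
  have hval : BoundedVariationOn (fun t : unitInterval => (t : ℝ)) Set.univ :=
    MonotoneOn.boundedVariationOn (C := 1) (fun _ _ _ _ h => h)
      fun t _ => by rw [abs_of_nonneg t.2.1]; exact t.2.2
  have := (hlip.comp (LipschitzWith.projIcc zero_le_one)).comp_boundedVariationOn hval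
  refine (show B = _ from ?_) ▸ this
  ext t
  simp

namespace ParamFlow

variable {σ : ℝ → ℝ → ℝ} (Φ : ParamFlow σ)

theorem contDiff_φ (hσ : Continuous fun p : ℝ × ℝ => σ p.1 p.2) : ContDiff ℝ 1 Φ.φ := by
  have hφ := Φ.continuous_φ
  have hP := Φ.continuous_P
  have hQ := Φ.continuous_Q
  have hR := Φ.continuous_R
  have hσφ : Continuous fun p : ℝ × ℝ × ℝ => σ p.1 (Φ.φ p) :=
    hσ.comp (continuous_fst.prodMk hφ)
  let L : ℝ × ℝ × ℝ → ℝ × ℝ × ℝ → (ℝ × ℝ × ℝ →L[ℝ] ℝ) := fun p q =>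
    Φ.Q (p.1, q.1, p.2.1, q.2.1, q.2.2) • ContinuousLinearMap.fst ℝ ℝ (ℝ × ℝ) +
    Φ.P (p.1, q.1, p.2.1, q.2.1, q.2.2) • (ContinuousLinearMap.fst ℝ ℝ ℝ).comp
      (ContinuousLinearMap.snd ℝ ℝ (ℝ × ℝ)) +
    (σ p.1 (Φ.φ p) + Φ.R (p.1, p.2.1, p.2.2, q.2.2) * (q.2.2 - p.2.2)) •
      (ContinuousLinearMap.snd ℝ ℝ ℝ).comp (ContinuousLinearMap.snd ℝ ℝ (ℝ × ℝ))
  refine contDiff_one_iff_hasFDerivAt.2 ⟨fun p => L p p, by simp only [L]; fun_prop, fun p => ?_⟩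
  refine hasFDerivAt_of_increment (L := L p) (Continuous.continuousAt
    (by simp only [L]; fun_prop)) fun q => ?_
  obtain ⟨t, ξ, τ⟩ := p
  obtain ⟨t', ξ', τ'⟩ := q
  have h1 := Φ.φ_increment t t' ξ ξ' τ'
  have h2 := Φ.φ_taylor t ξ τ τ'
  simp only [L, add_apply, smul_apply,
    ContinuousLinearMap.comp_apply, ContinuousLinearMap.coe_fst', ContinuousLinearMap.coe_snd',
    Prod.fst_sub, Prod.snd_sub, smul_eq_mul]
  linear_combination h1 + h2

/-- The primitive `f` is the flow itself, with `A(t) = (t, B(t))`: by the flow equation its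
derivative in the last variable is `σ(t, φ)`, and its second derivative there is `σ_u σ`. -/
theorem isAdmissibleIntegrand (hσ : ContDiff ℝ 2 fun p : ℝ × ℝ => σ p.1 p.2)
    (x : C(unitInterval, ℝ)) {B : unitInterval → ℝ} (hB : Continuous B)
    (hBV : BoundedVariationOn B Set.univ) :
    IsAdmissibleIntegrand x fun t => σ t (Φ.φ (t, B t, x t)) := by
  have hσ1 : ContDiff ℝ 1 fun p : ℝ × ℝ => σ p.1 p.2 := hσ.of_le one_le_two
  have hφ1 := Φ.contDiff_φ hσ.continuous
  have hφ := Φ.continuous_φ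
  have hderiv : ∀ a : Fin 2 → ℝ, deriv (fun ξ => Φ.φ (a 0, a 1, ξ)) =
      fun ξ => σ (a 0) (Φ.φ (a 0, a 1, ξ)) := fun a =>
    funext fun ξ => (Φ.hasDerivAt_φ _ _ _).deriv
  have hsec : ∀ a : Fin 2 → ℝ, ContDiff ℝ 1 fun ξ => Φ.φ (a 0, a 1, ξ) := fun a =>
    hφ1.comp (contDiff_const.prodMk (contDiff_const.prodMk contDiff_id))
  refine ⟨2, fun t => ![(t : ℝ), B t], Set.univ, fun p => Φ.φ (p.1 0, p.1 1, p.2), ?_, ?_,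
    isOpen_univ, fun _ => trivial, ?_, fun a => ?_, ?_, fun t => ?_⟩
  · refine continuous_pi fun i => ?_
    fin_cases i
    · exact continuous_subtype_val
    · exact hB
  · intro i
    fin_cases i
    · exact boundedVariationOn_of_abs_sub_le zero_le_one fun s t h => by
        have h' : (s : ℝ) ≤ t := h
        change |(t : ℝ) - s| ≤ 1 * (t - s)
        rw [one_mul, abs_of_nonneg (sub_nonneg.2 h')]
    · exact hBV
  · exact (hφ1.comp (by fun_prop)).contDiffOn
  · refine ContDiff.contDiffOn ?_
    rw [show (2 : WithTop ℕ∞) = 1 + 1 by norm_num, contDiff_succ_iff_deriv]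
    refine ⟨(hsec a).differentiable one_ne_zero, by simp, ?_⟩
    dsimp only
    rw [hderiv]
    exact hσ1.comp (contDiff_const.prodMk (hsec a))
  · refine Continuous.continuousOn ?_
    have h2 : ∀ p : (Fin 2 → ℝ) × ℝ, iteratedDeriv 2 (fun ξ => Φ.φ (p.1 0, p.1 1, ξ)) p.2 =
        fderiv ℝ (fun p : ℝ × ℝ => σ p.1 p.2) (p.1 0, Φ.φ (p.1 0, p.1 1, p.2)) (0, 1) *
          σ (p.1 0) (Φ.φ (p.1 0, p.1 1, p.2)) := by
      intro p
      rw [iteratedDeriv_succ, iteratedDeriv_one, hderiv]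
      exact ((hasDerivAt_snd_of_contDiff hσ1 _ _).comp p.2 (Φ.hasDerivAt_φ _ _ _)).deriv
    simp only [h2]
    have h3 : Continuous fun q : ℝ × ℝ => fderiv ℝ (fun p : ℝ × ℝ => σ p.1 p.2) q (0, 1) :=
      (hσ1.continuous_fderiv one_ne_zero).clm_apply continuous_const
    have h4 : Continuous fun p : (Fin 2 → ℝ) × ℝ => (p.1 0, Φ.φ (p.1 0, p.1 1, p.2)) := by
      fun_prop
    exact (h3.comp h4).mul (hσ1.continuous.comp h4)
  · exact (Φ.hasDerivAt_φ _ _ _).deriv.symm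

/-- The path `t ↦ φ(t, B(t), x(t))`. -/
def path (x B : C(unitInterval, ℝ)) : C(unitInterval, ℝ) :=
  ⟨fun t => Φ.φ (t, B t, x t), by have := Φ.continuous_φ; fun_prop⟩

theorem path_apply (x B : C(unitInterval, ℝ)) (t : unitInterval) :
    Φ.path x B t = Φ.φ (t, B t, x t) := rfl

/-- `∂φ/∂ξ` along the path. -/
def slopeB (x B : C(unitInterval, ℝ)) (t : unitInterval) : ℝ := Φ.P (t, t, B t, B t, x t)

/-- `∂φ/∂t + ½ ∂²φ/∂τ²` along the path. -/
def itoDrift (x B : C(unitInterval, ℝ)) (t : unitInterval) : ℝ :=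
  Φ.Q (t, t, B t, B t, x t) + Φ.R (t, B t, x t, x t)

theorem continuous_slopeB (x B : C(unitInterval, ℝ)) : Continuous (Φ.slopeB x B) := by
  have := Φ.continuous_P
  unfold slopeB
  fun_prop

theorem continuous_itoDrift (x B : C(unitInterval, ℝ)) : Continuous (Φ.itoDrift x B) := by
  have := Φ.continuous_Q
  have := Φ.continuous_R
  unfold itoDrift
  fun_prop

/-- A discrete Itô formula without error term. The parameters `(t, ξ)` are changed at the fixed flow
time `x u`, and the flow time at the fixed parameters `(s, B s)`. -/
theorem path_increment (x B : C(unitInterval, ℝ)) (s u : unitInterval) :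
    Φ.path x B u - Φ.path x B s - σ s (Φ.path x B s) * (x u - x s) =
      Φ.P (s, u, B s, B u, x u) * (B u - B s) +
        (Φ.Q (s, u, B s, B u, x u) * (u - s) + Φ.R (s, B s, x s, x u) * (x u - x s) ^ 2) := by
  have h1 := Φ.φ_increment s u (B s) (B u) (x u)
  have h2 := Φ.φ_taylor s (B s) (x s) (x u)
  simp only [path_apply]
  linear_combination h1 + h2

variable {T : RefiningPartitions}

theorem convWeights_drift {x : C(unitInterval, ℝ)} (hx : HasQuadVar T x (fun t => (t : ℝ)))
    (B : C(unitInterval, ℝ)) :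
    ConvWeights T (fun n s => Φ.Q (s, succIn (T.part n) s, B s, B (succIn (T.part n) s),
        x (succIn (T.part n) s)) * (succIn (T.part n) s - s) +
      Φ.R (s, B s, x s, x (succIn (T.part n) s)) * (x (succIn (T.part n) s) - x s) ^ 2)
      (timeIntegral (Φ.itoDrift x B)) := by
  have hQ := Φ.continuous_Q
  have hR := Φ.continuous_R
  have h1 := (convWeights_time T).mul_left continuous_const
    (H := fun q => Φ.Q (q.1, q.2, B q.1, B q.2, x q.2)) (by fun_prop)
  have h2 := (convWeights_sq hx).mul_left continuous_const
    (H := fun q => Φ.R (q.1, B q.1, x q.1, x q.2)) (by fun_prop)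
  have h := h1.add h2
  simp only [mul_one] at h
  convert h using 2 with t
  exact timeIntegral_add (by fun_prop) (by fun_prop) t

/-- The coefficients `P, Q, R` are inserted as continuous densities into the weights `ΔB`, `Δt`,
`(Δx)²`; in the limit only their diagonal values remain. -/
theorem convWeights_path {x : C(unitInterval, ℝ)} (hx : HasQuadVar T x (fun t => (t : ℝ)))
    {B : C(unitInterval, ℝ)} {β : unitInterval → ℝ} (hβ : Continuous β)
    (hB : ∀ t, B t = B 0 + timeIntegral β t) :
    ConvWeights T (fun n s => Φ.path x B (succIn (T.part n) s) - Φ.path x B s -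
      σ s (Φ.path x B s) * (x (succIn (T.part n) s) - x s))
      (timeIntegral fun s => Φ.slopeB x B s * β s + Φ.itoDrift x B s) := by
  have hP := Φ.continuous_P
  have h1 := (convWeights_timeIntegral T hβ).mul_left hβ
    (H := fun q => Φ.P (q.1, q.2, B q.1, B q.2, x q.2)) (by fun_prop)
  have h := h1.add (Φ.convWeights_drift hx B)
  have hBsub : ∀ s u, timeIntegral β u - timeIntegral β s = B u - B s := fun s u => by
    rw [hB u, hB s]; ring
  simp only [hBsub] at h
  simp only [path_increment]
  convert h using 2 with t
  exact timeIntegral_add ((Φ.continuous_slopeB x B).mul hβ) (Φ.continuous_itoDrift x B) t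

end ParamFlow

variable {T : RefiningPartitions}

/-- Write `(Δz)² = η² (Δx)² + (Δz + η Δx) (Δz - η Δx)`. In the last product the first factor is
uniformly small and the second has bounded total variation. -/
theorem hasQuadVar_of_convWeights {x z : C(unitInterval, ℝ)} {η b : unitInterval → ℝ}
    (hx : HasQuadVar T x (fun t => (t : ℝ))) (hη : Continuous η)
    (h : ConvWeights T (fun n s => z (succIn (T.part n) s) - z s -
      η s * (x (succIn (T.part n) s) - x s)) (timeIntegral b)) :
    HasQuadVar T z (timeIntegral fun s => η s ^ 2) := by
  intro t
  have h1 := ((convWeights_sq hx).mul_left continuous_const (H := fun q => η q.1 ^ 2)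
    (by fun_prop)).2 t
  obtain ⟨M, hM0, hM⟩ := exists_abs_le hη
  have h2 := tendsto_sum_zero_of_abs_le h.1 (e := fun n s =>
    (z (succIn (T.part n) s) - z s + η s * (x (succIn (T.part n) s) - x s)) *
    (z (succIn (T.part n) s) - z s - η s * (x (succIn (T.part n) s) - x s))) (fun ε hε => ?_) t
  · have h3 := h1.add h2
    simp only [mul_one, add_zero] at h3
    refine h3.congr fun n => ?_
    rw [← Finset.sum_add_distrib]
    exact Finset.sum_congr rfl fun s _ => by ring
  · have hε2 : 0 < ε / (M + 1) := by positivity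
    filter_upwards [T.eventually_dist_comp_succIn_lt z.continuous (half_pos hε),
      T.eventually_dist_comp_succIn_lt x.continuous (half_pos hε2)] with n hz hxn s
    rw [abs_mul]
    refine mul_le_mul_of_nonneg_right ((abs_add_le _ _).trans ?_) (abs_nonneg _)
    have h4 := (hz s).le
    have h5 := (hxn s).le
    rw [Real.dist_eq] at h4 h5
    rw [abs_mul]
    have h6 := mul_le_mul (hM s) h5 (abs_nonneg _) hM0
    have h7 : M * (ε / (M + 1) / 2) ≤ ε / 2 := by
      rw [← mul_div_assoc, ← mul_div_assoc]
      gcongr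
      rw [div_le_iff₀ (by positivity)]
      nlinarith
    linarith

/-- The Riemann sums are telescoping sums of `Δz` minus the weights, so the integral exists and
equals `z - z(0) - ∫ b`. -/
theorem isItoSolution_of_convWeights {x z : C(unitInterval, ℝ)} {σ : unitInterval → ℝ → ℝ}
    {b : unitInterval → ℝ} (hadm : IsAdmissibleIntegrand x fun t => σ t (z t))
    (h : ConvWeights T (fun n s => z (succIn (T.part n) s) - z s -
      σ s (z s) * (x (succIn (T.part n) s) - x s)) (timeIntegral b)) :
    IsItoSolution T x σ (fun t _ => b t) (z 0) z := by
  refine ⟨hadm, fun t => z t - z 0 - timeIntegral b t, fun t => ?_, fun t => by ring⟩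
  refine ((((z.continuous.tendsto t).comp (T.tendsto_succIn t)).sub_const (z 0)).sub
    (h.2 t)).congr fun n => ?_
  rw [Finset.sum_sub_distrib, sum_succIn_sub (T.zero_mem n) (T.one_mem n)]
  simp [riemannSum]

namespace ParamFlow

variable {σ : ℝ → ℝ → ℝ} (Φ : ParamFlow σ)

theorem isItoSolution_path (hσ : ContDiff ℝ 2 fun p : ℝ × ℝ => σ p.1 p.2)
    {x : C(unitInterval, ℝ)} (hx0 : x 0 = 0) (hx : HasQuadVar T x (fun t => (t : ℝ)))
    {B : C(unitInterval, ℝ)} {β b : unitInterval → ℝ} (hβ : Continuous β)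
    (hB : ∀ t, B t = B 0 + timeIntegral β t)
    (hb : ∀ t, b t = Φ.slopeB x B t * β t + Φ.itoDrift x B t) :
    IsItoSolution T x (fun t ξ => σ t ξ) (fun t _ => b t) (B 0) (Φ.path x B) := by
  obtain rfl : b = fun t => Φ.slopeB x B t * β t + Φ.itoDrift x B t := funext hb
  have h0 : Φ.path x B 0 = B 0 := by
    rw [path_apply, hx0, φ_zero]
  obtain ⟨M, hM0, hM⟩ := exists_abs_le hβ
  have hBV : BoundedVariationOn B Set.univ := by
    refine boundedVariationOn_of_abs_sub_le hM0 fun s t hst => ?_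
    rw [hB t, hB s, add_sub_add_left_eq_sub]
    exact abs_timeIntegral_sub_le hβ hst fun u _ _ => hM u
  rw [← h0]
  exact isItoSolution_of_convWeights (σ := fun t ξ => σ t ξ)
    (Φ.isAdmissibleIntegrand hσ x B.continuous hBV) (Φ.convWeights_path hx hβ hB)

theorem path_mem_localQuadVarClass (hσ : Continuous fun p : ℝ × ℝ => σ p.1 p.2)
    {x : C(unitInterval, ℝ)} (hx : HasQuadVar T x (fun t => (t : ℝ)))
    {B : C(unitInterval, ℝ)} {β : unitInterval → ℝ} (hβ : Continuous β)
    (hB : ∀ t, B t = B 0 + timeIntegral β t) :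
    Φ.path x B ∈ localQuadVarClass T fun t ξ => σ t ξ ^ 2 :=
  hasQuadVar_of_convWeights hx
    (hσ.comp (continuous_subtype_val.prodMk (Φ.path x B).continuous)) (Φ.convWeights_path hx hβ hB)

/-- The path `B` with `z(t) = φ(t, B(t), x(t))`. -/
def invPath (x z : C(unitInterval, ℝ)) : C(unitInterval, ℝ) :=
  ⟨fun t => Φ.φ (t, z t, -x t), by have := Φ.continuous_φ; fun_prop⟩

theorem path_invPath (x z : C(unitInterval, ℝ)) : Φ.path x (Φ.invPath x z) = z := by
  ext t
  have := Φ.φ_neg t (z t) (-x t)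
  rwa [neg_neg] at this

/-- A solution `z = φ(t, B(t), x(t))` determines a solution `B` of an ordinary integral equation. -/
theorem invPath_eq_of_isItoSolution {x z : C(unitInterval, ℝ)} (hx0 : x 0 = 0)
    (hx : HasQuadVar T x (fun t => (t : ℝ))) {b : unitInterval → ℝ} (hb : Continuous b) {z₀ : ℝ}
    (hz : IsItoSolution T x (fun t ξ => σ t ξ) (fun t _ => b t) z₀ z) (t : unitInterval) :
    Φ.invPath x z t = z₀ + timeIntegral (fun s => (Φ.slopeB x (Φ.invPath x z) s)⁻¹ *
      (b s - Φ.itoDrift x (Φ.invPath x z) s)) t := by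
  set B := Φ.invPath x z with hBdef
  have hB0 : B 0 = z₀ := by
    obtain ⟨-, J, hJ, hzJ⟩ := hz
    have h1 := hzJ 0
    rw [(hJ 0).zero_eq, timeIntegral_zero, add_zero, add_zero] at h1
    rw [← h1]
    change Φ.φ (_, z 0, -x 0) = z 0
    rw [hx0, neg_zero, φ_zero]
  have hP := Φ.continuous_P
  -- The discrete Itô formula is solved for `ΔB`: subtract the drift weights from `Δz - σ Δx` and
  -- insert the density `P⁻¹`. The sums of `ΔB` telescope, and uniqueness of limits gives the
  -- equation.
  have hw := (hz.convWeights hb hx).add (Φ.convWeights_drift hx B).neg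
  have hdc := Φ.continuous_itoDrift x B
  have hρ : (fun t => timeIntegral b t + -timeIntegral (Φ.itoDrift x B) t) =
      timeIntegral fun s => b s - Φ.itoDrift x B s := by
    ext t
    rw [← timeIntegral_neg, ← timeIntegral_add hb (by fun_prop)]
    simp only [sub_eq_add_neg]
  rw [hρ] at hw
  have h := (hw.mul_left (by fun_prop)
    (H := fun q => (Φ.P (q.1, q.2, B q.1, B q.2, x q.2))⁻¹)
    (Continuous.inv₀ (by fun_prop) fun q => (Φ.P_pos _).ne')).2 t
  have hinc := Φ.path_increment x B
  rw [hBdef, path_invPath, ← hBdef] at hinc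
  have hlim : Tendsto (fun n => B (succIn (T.part n) t) - B 0) atTop (𝓝 (B t - B 0)) :=
    ((B.continuous.tendsto t).comp (T.tendsto_succIn t)).sub_const _
  have := tendsto_nhds_unique hlim (h.congr fun n => ?_)
  · rw [hB0] at this
    exact sub_eq_iff_eq_add'.1 this
  · rw [← sum_succIn_sub (T.zero_mem n) (T.one_mem n)]
    refine Finset.sum_congr rfl fun s _ => ?_
    dsimp only
    rw [hinc, add_neg_cancel_right, inv_mul_cancel_left₀ (Φ.P_pos _).ne']

end ParamFlow

/-! ### The ordinary integral equation for `B` -/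

/-- `y(t) = y₀ + ∫₀ᵗ p(s, y(s)) (b - d(s, y(s))) ds`. -/
def IsIntegralSol (p d : unitInterval × ℝ → ℝ) (b y₀ : ℝ) (y : C(unitInterval, ℝ)) : Prop :=
  ∀ t, y t = y₀ + timeIntegral (fun s => p (s, y s) * (b - d (s, y s))) t

/-- The coefficients `p, d` are locally Lipschitz, `p` is bounded above and below, and `d` has
linear growth. -/
structure DriftCoeffs (p d : unitInterval × ℝ → ℝ) (K : ℝ) : Prop where
  slope_p : HasContSlope p
  slope_d : HasContSlope d
  pos : ∀ q, 0 < p q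
  le : ∀ q, p q ≤ K
  inv_le : ∀ q, (p q)⁻¹ ≤ K
  growth : ∀ q, |d q| ≤ K * (1 + |q.2|)

theorem IsIntegralSol.apply_zero {p d : unitInterval × ℝ → ℝ} {b y₀ : ℝ} {y : C(unitInterval, ℝ)}
    (h : IsIntegralSol p d b y₀ y) : y 0 = y₀ := by
  rw [h 0, timeIntegral_zero, add_zero]

/-- The right hand side of the differential equation, extended to all times. -/
def driftField (p d : unitInterval × ℝ → ℝ) (b : ℝ) (u ξ : ℝ) : ℝ :=
  p (Set.projIcc 0 1 zero_le_one u, ξ) * (b - d (Set.projIcc 0 1 zero_le_one u, ξ))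

theorem IsIntegralSol.hasDerivWithinAt {p d : unitInterval × ℝ → ℝ} (hp : Continuous p)
    (hd : Continuous d) {b y₀ : ℝ} {y : C(unitInterval, ℝ)} (h : IsIntegralSol p d b y₀ y) {u : ℝ}
    (hu : u ∈ Set.Ico (0 : ℝ) 1) :
    HasDerivWithinAt (fun u => y (Set.projIcc 0 1 zero_le_one u))
      (driftField p d b u (y (Set.projIcc 0 1 zero_le_one u))) (Set.Ici u) u := by
  set g : unitInterval → ℝ := fun s => p (s, y s) * (b - d (s, y s)) with hg
  have hgc : Continuous g := by fun_prop
  have hgc' := continuous_comp_projIcc hgc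
  have h1 : HasDerivAt (fun u => y₀ + ∫ s in (0 : ℝ)..u, g (Set.projIcc 0 1 zero_le_one s))
      (g (Set.projIcc 0 1 zero_le_one u)) u :=
    (intervalIntegral.integral_hasDerivAt_right (hgc'.intervalIntegrable _ _)
      (hgc'.stronglyMeasurableAtFilter _ _) hgc'.continuousAt).const_add y₀
  have heq : ∀ w ∈ Set.Icc (0 : ℝ) 1, y (Set.projIcc 0 1 zero_le_one w) =
      y₀ + ∫ s in (0 : ℝ)..w, g (Set.projIcc 0 1 zero_le_one s) := by
    intro w hw
    rw [Set.projIcc_of_mem zero_le_one hw]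
    exact h ⟨w, hw⟩
  refine h1.hasDerivWithinAt.congr_of_eventuallyEq ?_ (heq u ⟨hu.1, hu.2.le⟩)
  filter_upwards [self_mem_nhdsWithin, mem_nhdsWithin_of_mem_nhds (Iio_mem_nhds hu.2)] with w h2 h3
  exact heq w ⟨hu.1.trans h2, le_of_lt h3⟩

namespace DriftCoeffs

variable {p d : unitInterval × ℝ → ℝ} {K : ℝ}

theorem K_nonneg (h : DriftCoeffs p d K) : 0 ≤ K := (h.pos (0, 0)).le.trans (h.le _)

theorem abs_driftField_le (h : DriftCoeffs p d K) (b u ξ : ℝ) :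
    |driftField p d b u ξ| ≤ K ^ 2 * |ξ| + (K * |b| + K ^ 2) := by
  have hK := h.K_nonneg
  rw [driftField, abs_mul, abs_of_pos (h.pos _)]
  have h1 := h.growth (Set.projIcc 0 1 zero_le_one u, ξ)
  have h2 := abs_sub b (d (Set.projIcc 0 1 zero_le_one u, ξ))
  have h3 := mul_le_mul (h.le (Set.projIcc 0 1 zero_le_one u, ξ)) (h2.trans (by
    exact add_le_add_right h1 |b|)) (abs_nonneg _) hK
  refine h3.trans (le_of_eq ?_)
  ring

/-- The field has a continuous difference quotient, which is bounded on the compact set `[0,1] ×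
[-R, R]²`. -/
theorem exists_lipschitz (h : DriftCoeffs p d K) (b R : ℝ) :
    ∃ L : NNReal, ∀ u, LipschitzOnWith L (driftField p d b u) (Set.Icc (-R) R) := by
  have hs : HasContSlope fun q => p q * (b + -d q) :=
    h.slope_p.mul ((HasContSlope.const (g := fun _ => b) continuous_const).add h.slope_d.neg)
  obtain ⟨-, Γ, hΓ, hs⟩ := hs
  obtain ⟨C, hC⟩ := (isCompact_univ (X := unitInterval)).prod
    ((isCompact_Icc (a := -R) (b := R)).prod (isCompact_Icc (a := -R) (b := R)))
      |>.exists_bound_of_continuousOn hΓ.continuousOn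
  refine ⟨⟨|C|, abs_nonneg C⟩, fun u => LipschitzOnWith.of_dist_le_mul fun ξ hξ ζ hζ => ?_⟩
  rw [Real.dist_eq, Real.dist_eq]
  have h1 := hs (Set.projIcc 0 1 zero_le_one u) ζ ξ
  simp only [← sub_eq_add_neg] at h1
  rw [driftField, driftField, h1, abs_mul]
  exact mul_le_mul_of_nonneg_right ((hC _ ⟨trivial, hζ, hξ⟩).trans (le_abs_self C)) (abs_nonneg _)

/-- A priori bound for the solutions. -/
def bound (K b y₀ : ℝ) : ℝ := gronwallBound |y₀| (K ^ 2) (K * |b| + K ^ 2) 1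

theorem abs_le_bound (hK : 0 ≤ K) {b y₀ : ℝ} {f f' : ℝ → ℝ} (hf : ContinuousOn f (Set.Icc 0 1))
    (hf' : ∀ u ∈ Set.Ico (0 : ℝ) 1, HasDerivWithinAt f (f' u) (Set.Ici u) u) (h0 : f 0 = y₀)
    (hb : ∀ u ∈ Set.Ico (0 : ℝ) 1, |f' u| ≤ K ^ 2 * |f u| + (K * |b| + K ^ 2)) {u : ℝ}
    (hu : u ∈ Set.Icc (0 : ℝ) 1) : |f u| ≤ bound K b y₀ := by
  refine (norm_le_gronwallBound_of_norm_deriv_right_le hf hf' (by rw [h0, Real.norm_eq_abs]) hb u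
    hu).trans ?_
  exact gronwallBound_mono (abs_nonneg _) (by positivity) (by positivity) (by simpa using hu.2)

theorem abs_sol_le (h : DriftCoeffs p d K) {b y₀ : ℝ} {y : C(unitInterval, ℝ)}
    (hy : IsIntegralSol p d b y₀ y) (t : unitInterval) : |y t| ≤ bound K b y₀ := by
  have := abs_le_bound h.K_nonneg (y₀ := y₀) (b := b)
    (continuous_comp_projIcc y.continuous).continuousOn
    (fun u hu => hy.hasDerivWithinAt h.slope_p.1 h.slope_d.1 hu) (by simpa using hy.apply_zero)
    (fun u _ => h.abs_driftField_le b u _) t.2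
  simpa using this

theorem bound_mono (hK : 0 ≤ K) (y₀ : ℝ) {b β : ℝ} (hb : |b| ≤ β) :
    bound K b y₀ ≤ bound K β y₀ := by
  have hβ := hb.trans (le_abs_self β)
  unfold bound gronwallBound
  split_ifs with h0
  · gcongr
  · have : 0 < K ^ 2 := lt_of_le_of_ne (by positivity) (Ne.symm h0)
    have h1 : 0 ≤ Real.exp (K ^ 2 * 1) - 1 := by
      rw [sub_nonneg]; exact Real.one_le_exp (by positivity)
    gcongr

/-- Grönwall: `y'` solves the equation of `y` up to an error of at most `K |b - b'|`. The a priori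
bound keeps both solutions in one interval, on which the fields with `|b| ≤ β` share a Lipschitz
constant because they are affine in `b`. -/
theorem exists_abs_sub_le (h : DriftCoeffs p d K) (y₀ β : ℝ) :
    ∃ L : ℝ, ∀ b b' y y', |b| ≤ β → |b'| ≤ β → IsIntegralSol p d b y₀ y →
      IsIntegralSol p d b' y₀ y' → ∀ t : unitInterval,
        |y t - y' t| ≤ gronwallBound 0 L (K * |b - b'|) t := by
  -- the Lipschitz constant can be chosen independently of `b`
  obtain ⟨L₀, hL₀⟩ := h.exists_lipschitz 0 (bound K β y₀)
  obtain ⟨L₁, hL₁⟩ := h.exists_lipschitz 1 (bound K β y₀)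
  have hlip : ∀ b, |b| ≤ β → ∀ u, LipschitzOnWith (⟨|β|, abs_nonneg β⟩ * (L₁ + L₀) + L₀)
      (driftField p d b u) (Set.Icc (-bound K β y₀) (bound K β y₀)) := by
    intro b hb u
    refine LipschitzOnWith.of_dist_le_mul fun ξ hξ ζ hζ => ?_
    have h0 := (hL₀ u).dist_le_mul ξ hξ ζ hζ
    have h1 := (hL₁ u).dist_le_mul ξ hξ ζ hζ
    rw [Real.dist_eq] at h0 h1 ⊢
    have e : driftField p d b u ξ - driftField p d b u ζ =
        b * ((driftField p d 1 u ξ - driftField p d 1 u ζ) -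
          (driftField p d 0 u ξ - driftField p d 0 u ζ)) +
        (driftField p d 0 u ξ - driftField p d 0 u ζ) := by
      simp only [driftField]; ring
    rw [e]
    change _ ≤ (|β| * ((L₁ : ℝ) + L₀) + L₀) * dist ξ ζ
    refine (abs_add_le _ _).trans ?_
    rw [abs_mul, add_mul, mul_assoc]
    refine add_le_add (mul_le_mul (hb.trans (le_abs_self β)) ?_ (abs_nonneg _) (abs_nonneg _)) h0
    rw [add_mul]
    exact (abs_sub _ _).trans (add_le_add h1 h0)
  refine ⟨(⟨|β|, abs_nonneg β⟩ * (L₁ + L₀) + L₀ : NNReal), ?_⟩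
  intro b b' y y' hb hb' hy hy' t
  have hmem : ∀ {b y}, |b| ≤ β → IsIntegralSol p d b y₀ y → ∀ s : unitInterval,
      y s ∈ Set.Icc (-bound K β y₀) (bound K β y₀) := fun hb hy s =>
    abs_le.1 ((h.abs_sol_le hy s).trans (bound_mono h.K_nonneg y₀ hb))
  have := dist_le_of_approx_trajectories_ODE_of_mem (a := 0) (b := 1) (δ := 0) (εf := 0)
    (εg := K * |b - b'|) (v := driftField p d b)
    (s := fun _ => Set.Icc (-bound K β y₀) (bound K β y₀))
    (fun u _ => hlip b hb u)
    (continuous_comp_projIcc y.continuous).continuousOn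
    (fun u hu => hy.hasDerivWithinAt h.slope_p.1 h.slope_d.1 hu)
    (fun u _ => by rw [dist_self]) (fun u _ => hmem hb hy _)
    (continuous_comp_projIcc y'.continuous).continuousOn
    (fun u hu => hy'.hasDerivWithinAt h.slope_p.1 h.slope_d.1 hu)
    (fun u _ => ?_) (fun u _ => hmem hb' hy' _)
    (by simp [hy.apply_zero, hy'.apply_zero]) t t.2
  · simpa [Real.dist_eq] using this
  · rw [Real.dist_eq, driftField, driftField, ← mul_sub, sub_sub_sub_cancel_right, abs_mul,
      abs_of_pos (h.pos _), abs_sub_comm b' b]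
    exact mul_le_mul_of_nonneg_right (h.le _) (abs_nonneg _)

theorem eq_of_isIntegralSol (h : DriftCoeffs p d K) {b y₀ : ℝ} {y y' : C(unitInterval, ℝ)}
    (hy : IsIntegralSol p d b y₀ y) (hy' : IsIntegralSol p d b y₀ y') : y = y' := by
  obtain ⟨L, hL⟩ := h.exists_abs_sub_le y₀ |b|
  ext t
  have := hL b b y y' le_rfl le_rfl hy hy' t
  rw [sub_self, abs_zero, mul_zero, gronwallBound_ε0_δ0] at this
  exact sub_eq_zero.1 (abs_nonpos_iff.1 this)

theorem continuous_apply (h : DriftCoeffs p d K) {y₀ : ℝ} {y : ℝ → C(unitInterval, ℝ)}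
    (hy : ∀ b, IsIntegralSol p d b y₀ (y b)) (t : unitInterval) : Continuous fun b => y b t := by
  rw [continuous_iff_continuousAt]
  intro b
  obtain ⟨L, hL⟩ := h.exists_abs_sub_le y₀ (|b| + 1)
  have hlim : Tendsto (fun b' => gronwallBound 0 L (K * |b' - b|) t) (𝓝 b) (𝓝 0) := by
    have hc : Continuous fun b' => gronwallBound 0 L (K * |b' - b|) t :=
      (gronwallBound_continuous_ε 0 L t).comp (by fun_prop)
    convert hc.tendsto b using 2
    simp [gronwallBound_ε0_δ0]
  refine tendsto_iff_dist_tendsto_zero.2 (squeeze_zero' (Eventually.of_forall fun _ => dist_nonneg)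
    ?_ hlim)
  filter_upwards [Metric.ball_mem_nhds b one_pos] with b' hb'
  rw [Metric.mem_ball, Real.dist_eq] at hb'
  refine hL b' b _ _ ?_ (by linarith) (hy b') (hy b) t
  have := abs_add_le (b' - b) b
  rw [sub_add_cancel] at this
  linarith

/-- Clipping the space variable to `[-R, R]` makes the field bounded and globally Lipschitz, so
Picard–Lindelöf applies on all of `[0,1]`. The clipped field keeps the linear growth bound, hence
the solution stays in `[-R, R]` and the clipping is inactive. -/
theorem exists_isIntegralSol (h : DriftCoeffs p d K) (b y₀ : ℝ) :
    ∃ y, IsIntegralSol p d b y₀ y := by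
  have hK := h.K_nonneg
  set R := bound K b y₀ with hR
  have hR0 : 0 ≤ R := (abs_nonneg y₀).trans (by
    have := gronwallBound_mono (abs_nonneg y₀) (ε := K * |b| + K ^ 2) (K := K ^ 2) (by positivity)
      (by positivity) zero_le_one
    rwa [gronwallBound_x0] at this)
  have hRR : -R ≤ R := by linarith
  obtain ⟨L, hL⟩ := h.exists_lipschitz b R
  set clip : ℝ → ℝ := fun ξ => Set.projIcc (-R) R hRR ξ with hclip
  have hclipR : ∀ ξ, clip ξ ∈ Set.Icc (-R) R := fun ξ => (Set.projIcc (-R) R hRR ξ).2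
  have hclip_le : ∀ ξ, |clip ξ| ≤ |ξ| := by
    intro ξ
    have := (LipschitzWith.projIcc hRR).dist_le_mul ξ 0
    rw [Subtype.dist_eq, Set.projIcc_of_mem hRR ⟨by linarith, hR0⟩] at this
    simpa using this
  set N : NNReal := ⟨K ^ 2 * R + (K * |b| + K ^ 2), by positivity⟩ with hN
  have hpc := h.slope_p.1
  have hdc := h.slope_d.1
  have hPL : IsPicardLindelof (fun u ξ => driftField p d b u (clip ξ)) (tmin := 0) (tmax := 1)
      ⟨0, by simp⟩ y₀ N 0 N L := by
    refine ⟨fun u _ => ?_, fun ξ _ => ?_, fun u _ ξ _ => ?_, ?_⟩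
    · refine LipschitzOnWith.of_dist_le_mul fun ξ _ ζ _ => ?_
      refine ((hL u).dist_le_mul _ (hclipR ξ) _ (hclipR ζ)).trans ?_
      refine mul_le_mul_of_nonneg_left ?_ L.2
      have := (LipschitzWith.projIcc hRR).dist_le_mul ξ ζ
      rwa [NNReal.coe_one, one_mul] at this
    · have : Continuous fun u => driftField p d b u (clip ξ) := by
        unfold driftField
        have := continuous_projIcc (a := (0 : ℝ)) (b := 1) (h := zero_le_one)
        fun_prop
      exact this.continuousOn
    · refine (h.abs_driftField_le b u _).trans ?_
      change _ ≤ K ^ 2 * R + (K * |b| + K ^ 2)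
      gcongr
      exact abs_le.2 (hclipR ξ)
    · simp
  obtain ⟨α, h0, hα⟩ := hPL.exists_eq_forall_mem_Icc_hasDerivWithinAt₀
  have hαc : ContinuousOn α (Set.Icc 0 1) := fun u hu => (hα u hu).continuousWithinAt
  have hαb : ∀ u ∈ Set.Icc (0 : ℝ) 1, |α u| ≤ R := fun u hu =>
    abs_le_bound hK (b := b) hαc (fun u hu => (hα u ⟨hu.1, hu.2.le⟩).mono_of_mem_nhdsWithin
      (mem_of_superset (Icc_mem_nhdsGE hu.2) (Set.Icc_subset_Icc_left hu.1))) h0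
      (fun u _ => (h.abs_driftField_le b u _).trans (by
        have := mul_le_mul_of_nonneg_left (hclip_le (α u)) (sq_nonneg K)
        linarith)) hu
  have hαclip : ∀ u ∈ Set.Icc (0 : ℝ) 1, clip (α u) = α u := fun u hu => by
    rw [hclip]
    simp only [Set.projIcc_of_mem hRR (abs_le.1 (hαb u hu))]
  refine ⟨⟨fun t => α t, hαc.comp_continuous continuous_subtype_val fun t => t.2⟩, fun t => ?_⟩
  have hα' : Continuous fun s : unitInterval => (s, α s) :=
    continuous_id.prodMk (hαc.comp_continuous continuous_subtype_val fun t => t.2)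
  have hint : Continuous fun s : unitInterval => p (s, α s) * (b - d (s, α s)) :=
    (hpc.comp hα').mul (continuous_const.sub (hdc.comp hα'))
  have key := intervalIntegral.integral_eq_sub_of_hasDerivAt_of_le (a := 0) (b := (t : ℝ)) (f := α)
    (f' := fun u => p (Set.projIcc 0 1 zero_le_one u, α (Set.projIcc 0 1 zero_le_one u)) *
      (b - d (Set.projIcc 0 1 zero_le_one u, α (Set.projIcc 0 1 zero_le_one u)))) t.2.1
    (hαc.mono (Set.Icc_subset_Icc_right t.2.2)) (fun u hu => ?_)
    ((continuous_comp_projIcc hint).intervalIntegrable _ _)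
  · change α t = y₀ + ∫ u in (0 : ℝ)..t, _
    refine (eq_add_of_sub_eq' ?_)
    rw [← h0]
    exact key.symm
  · have hu1 : u ∈ Set.Icc (0 : ℝ) 1 := ⟨hu.1.le, hu.2.le.trans t.2.2⟩
    have := (hα u hu1).hasDerivAt (Icc_mem_nhds hu.1 (hu.2.trans_le t.2.2))
    rw [hαclip u hu1] at this
    simpa [driftField, Set.projIcc_of_mem zero_le_one hu1] using this

end DriftCoeffs

/-! ### Hitting a target by a constant drift -/

/-- A function whose right derivative exceeds `2M/τ` as long as it lies in `[-M, M]`, and which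
starts there, is at least `M` at time `τ`. -/
theorem le_of_deriv_right_gt {f f' : ℝ → ℝ} {τ M : ℝ} (hτ : 0 < τ)
    (hf : ContinuousOn f (Set.Icc 0 τ))
    (hf' : ∀ u ∈ Set.Ico 0 τ, HasDerivWithinAt f (f' u) (Set.Ici u) u) (h0 : |f 0| ≤ M)
    (hM : ∀ u ∈ Set.Ico 0 τ, |f u| ≤ M → 2 * M / τ < f' u) : M ≤ f τ := by
  have h0' := abs_le.1 h0
  -- The chord from `f 0` to `M` serves as a barrier. Its slope is at most `2M/τ`, and at a contact
  -- point `|f| ≤ M`, so `f` cannot cross below it.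
  set v := (M - f 0) / τ with hv
  have hv0 : 0 ≤ v := div_nonneg (by linarith) hτ.le
  have hvτ : v * τ = M - f 0 := div_mul_cancel₀ _ hτ.ne'
  have hv2 : v ≤ 2 * M / τ := div_le_div_of_nonneg_right (by linarith) hτ.le
  have := image_le_of_deriv_right_lt_deriv_boundary (f := fun u => -f u) (f' := fun u => -f' u)
    (B := fun u => -(f 0 + v * u)) (B' := fun _ => -v) (a := 0) (b := τ) hf.neg
    (fun u hu => (hf' u hu).fun_neg) (by simp)
    (fun u => by
      have := (((hasDerivAt_id u).const_mul v).const_add (f 0)).fun_neg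
      simpa using this)
    (fun u hu h => by
      have h1 : f u = f 0 + v * u := neg_injective h
      have h2 : v * u ≤ v * τ := mul_le_mul_of_nonneg_left hu.2.le hv0
      have h3 : 0 ≤ v * u := mul_nonneg hv0 hu.1
      have := hM u hu (by rw [h1, abs_le]; constructor <;> linarith)
      linarith) (Set.right_mem_Icc.2 hτ.le)
  have h4 : -f τ ≤ -(f 0 + v * τ) := this
  linarith

/-- The value at `t₀` depends continuously on `b`. A large positive `b` carries it above `M ≥ |y₁|`,
its negative below `-M`, and the intermediate value theorem gives the rest. -/
theorem DriftCoeffs.exists_hits {p d : unitInterval × ℝ → ℝ} {K : ℝ} (h : DriftCoeffs p d K)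
    (y₀ y₁ : ℝ) {t₀ : unitInterval} (ht₀ : 0 < t₀) :
    ∃ b y, IsIntegralSol p d b y₀ y ∧ y t₀ = y₁ := by
  have hτ : (0 : ℝ) < t₀ := ht₀
  choose y hy using fun b => h.exists_isIntegralSol b y₀
  have hcont := h.continuous_apply hy t₀
  set M := max |y₀| |y₁| with hM
  have hM0 : 0 ≤ M := (abs_nonneg _).trans (le_max_left _ _)
  have hK : 0 < K := (h.pos (0, 0)).trans_le (h.le _)
  -- The first term absorbs `d` on `[-M, M]`, the second yields speed `2M/t₀` after multiplication
  -- by `p ≥ K⁻¹`, and the third makes the inequality strict.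
  set b₁ := K * (1 + M) + K * (2 * M / t₀) + K with hb₁
  -- the drift dominates on `[-M, M]`
  have hdom : ∀ u ξ c, |ξ| ≤ M → |c| ≤ K * (1 + M) →
      2 * M / t₀ < p (u, ξ) * (b₁ - c) := by
    intro u ξ c _ hc
    have h1 : K⁻¹ ≤ p (u, ξ) := by
      rw [inv_le_comm₀ hK (h.pos _)]; exact h.inv_le _
    have h2 : K * (2 * M / t₀ + 1) ≤ b₁ - c := by
      have := (abs_le.1 hc).2
      rw [hb₁]; linarith
    have h3 : 0 ≤ 2 * M / (t₀ : ℝ) := by positivity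
    calc 2 * M / (t₀ : ℝ) < K⁻¹ * (K * (2 * M / t₀ + 1)) := by
          rw [inv_mul_cancel_left₀ hK.ne']; linarith
      _ ≤ p (u, ξ) * (b₁ - c) := mul_le_mul h1 h2 (by positivity) (h.pos _).le
  have hgrowth : ∀ u ξ, |ξ| ≤ M → |d (u, ξ)| ≤ K * (1 + M) := fun u ξ hξ =>
    (h.growth _).trans (by gcongr)
  have hsub : Set.Ico (0 : ℝ) t₀ ⊆ Set.Ico 0 1 := Set.Ico_subset_Ico_right t₀.2.2
  have hy0 : ∀ b, |y b (Set.projIcc 0 1 zero_le_one (0 : ℝ))| ≤ M := fun b => by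
    rw [Set.projIcc_left]
    exact (congrArg abs (hy b).apply_zero).trans_le (le_max_left _ _)
  have hup : M ≤ y b₁ t₀ := by
    have := le_of_deriv_right_gt hτ (continuous_comp_projIcc (y b₁).continuous).continuousOn
      (fun u hu => (hy b₁).hasDerivWithinAt h.slope_p.1 h.slope_d.1 (hsub hu)) (hy0 b₁)
      (fun u _ hu => hdom _ _ _ hu (hgrowth _ _ hu))
    simpa using this
  have hdown : M ≤ -y (-b₁) t₀ := by
    have := le_of_deriv_right_gt hτ
      (continuous_comp_projIcc (y (-b₁)).continuous).neg.continuousOn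
      (fun u hu => ((hy (-b₁)).hasDerivWithinAt h.slope_p.1 h.slope_d.1 (hsub hu)).fun_neg)
      (M := M) (by rw [Pi.neg_apply, abs_neg]; exact hy0 _)
      (fun u _ hu => by
        rw [Pi.neg_apply, abs_neg] at hu
        have := hdom (Set.projIcc 0 1 zero_le_one u) _
          (-d (Set.projIcc 0 1 zero_le_one u, y (-b₁) (Set.projIcc 0 1 zero_le_one u))) hu
          (by rw [abs_neg]; exact hgrowth _ _ hu)
        rw [driftField]
        linarith)
    simpa using this
  have hy1 := abs_le.1 (le_max_right |y₀| |y₁|)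
  obtain ⟨b, hb⟩ := mem_range_of_exists_le_of_exists_ge hcont
    ⟨-b₁, show y (-b₁) t₀ ≤ y₁ by linarith⟩ ⟨b₁, show y₁ ≤ y b₁ t₀ by linarith⟩
  exact ⟨b, y b, hy b, hb⟩

/-! ### Return to the pathwise equation; density -/

namespace ParamFlow

variable {σ : ℝ → ℝ → ℝ} (Φ : ParamFlow σ)

theorem exists_driftCoeffs (x : C(unitInterval, ℝ)) :
    ∃ K, DriftCoeffs (fun q => (Φ.P (q.1, q.1, q.2, q.2, x q.1))⁻¹)
      (fun q => Φ.Q (q.1, q.1, q.2, q.2, x q.1) + Φ.R (q.1, q.2, x q.1, x q.1)) K := by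
  obtain ⟨X, -, hX⟩ := exists_abs_le x.continuous
  obtain ⟨K, hK, hg⟩ := Φ.growth 1 X
  have hb := fun q : unitInterval × ℝ =>
    hg q.1 q.2 (x q.1) (by rw [abs_of_nonneg q.1.2.1]; exact q.1.2.2) (hX q.1)
  have hπ : Continuous fun s : unitInterval => ((s : ℝ), x s) := by fun_prop
  exact ⟨K, Φ.slope_inv.comp_param hπ, Φ.slope_drift.comp_param hπ,
    fun q => inv_pos.2 (Φ.P_pos _), fun q => (hb q).2.1, fun q => by rw [inv_inv]; exact (hb q).1,
    fun q => (hb q).2.2⟩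

theorem path_apply_of_eq {x B : C(unitInterval, ℝ)} {t : unitInterval} {ζ : ℝ}
    (h : B t = Φ.φ (t, ζ, -x t)) : Φ.path x B t = ζ := by
  have := Φ.φ_neg t ζ (-x t)
  rwa [neg_neg, ← h] at this

/-- Existence, uniqueness and the hitting property pass through the bijection between `B` and `z`;
the target for `B` is the preimage of `z₁` under the flow at time `x t₀`. -/
theorem exists_constant_drift (Φ : ParamFlow σ) {T : RefiningPartitions}
    (hσ : ContDiff ℝ 2 fun p : ℝ × ℝ => σ p.1 p.2) {x : C(unitInterval, ℝ)} (hx0 : x 0 = 0)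
    (hx : HasQuadVar T x (fun t => (t : ℝ))) (z₀ z₁ : ℝ) {t₀ : unitInterval} (ht₀ : 0 < t₀) :
    ∃ (b : ℝ) (z : C(unitInterval, ℝ)),
      IsItoSolution T x (fun t ξ => σ t ξ) (fun _ _ => b) z₀ z ∧
      (∀ w : C(unitInterval, ℝ),
        IsItoSolution T x (fun t ξ => σ t ξ) (fun _ _ => b) z₀ w → w = z) ∧
      z t₀ = z₁ := by
  obtain ⟨K, hK⟩ := Φ.exists_driftCoeffs x
  obtain ⟨b, y, hy, hyt⟩ := hK.exists_hits z₀ (Φ.φ (t₀, z₁, -x t₀)) ht₀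
  have hy0 := hy.apply_zero
  refine ⟨b, Φ.path x y, ?_, fun w hw => ?_, Φ.path_apply_of_eq hyt⟩
  · have hs := Φ.continuous_slopeB x y
    have hd := Φ.continuous_itoDrift x y
    have hne : ∀ t, Φ.slopeB x y t ≠ 0 := fun t => (Φ.P_pos _).ne'
    rw [← hy0]
    refine Φ.isItoSolution_path hσ hx0 hx
      (β := fun s => (Φ.slopeB x y s)⁻¹ * (b - Φ.itoDrift x y s))
      (by fun_prop (disch := exact hne _)) (fun t => ?_) fun t => ?_
    · rw [hy0]; exact hy t
    · rw [mul_inv_cancel_left₀ (hne t), sub_add_cancel]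
  · have hw' : IsIntegralSol (fun q => (Φ.P (q.1, q.1, q.2, q.2, x q.1))⁻¹)
        (fun q => Φ.Q (q.1, q.1, q.2, q.2, x q.1) + Φ.R (q.1, q.2, x q.1, x q.1)) b z₀
        (Φ.invPath x w) :=
      Φ.invPath_eq_of_isItoSolution hx0 hx (b := fun _ => b) continuous_const hw
    rw [← Φ.path_invPath x w, hK.eq_of_isIntegralSol hw' hy]

theorem continuous_path (x : C(unitInterval, ℝ)) : Continuous (Φ.path x) := by
  refine ContinuousMap.continuous_of_continuous_uncurry _ ?_
  have := Φ.continuous_φ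
  change Continuous fun q : C(unitInterval, ℝ) × unitInterval => Φ.φ (q.2, q.1 q.2, x q.2)
  fun_prop

end ParamFlow

/-- Polynomials are primitives of continuous functions and are dense by Weierstrass. -/
theorem dense_primitives : Dense {B : C(unitInterval, ℝ) |
    ∃ β : unitInterval → ℝ, Continuous β ∧ ∀ t, B t = B 0 + timeIntegral β t} := by
  have h : Dense (polynomialFunctions unitInterval : Set C(unitInterval, ℝ)) := by
    rw [dense_iff_closure_eq, ← Subalgebra.topologicalClosure_coe,
      polynomialFunctions_closure_eq_top', Algebra.coe_top]
  refine h.mono ?_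
  rw [polynomialFunctions_coe]
  rintro _ ⟨P, rfl⟩
  refine ⟨fun t => P.derivative.eval (t : ℝ), by fun_prop, fun t => ?_⟩
  have h1 : timeIntegral (fun t => P.derivative.eval (t : ℝ)) t =
      ∫ u in (0 : ℝ)..t, P.derivative.eval u := by
    refine intervalIntegral.integral_congr fun u hu => ?_
    rw [Set.uIcc_of_le t.2.1] at hu
    simp only [Set.projIcc_of_mem zero_le_one (⟨hu.1, hu.2.trans t.2.2⟩ : u ∈ Set.Icc (0 : ℝ) 1)]
  rw [h1, intervalIntegral.integral_eq_sub_of_hasDerivAt (fun u _ => P.hasDerivAt u)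
    (P.derivative.continuous.intervalIntegrable _ _)]
  simp

namespace ParamFlow

variable {σ : ℝ → ℝ → ℝ} (Φ : ParamFlow σ)

theorem dense_of_forall_path_mem {x : C(unitInterval, ℝ)} {S : Set C(unitInterval, ℝ)}
    (hS : ∀ (B : C(unitInterval, ℝ)) (β : unitInterval → ℝ), Continuous β →
      (∀ t, B t = B 0 + timeIntegral β t) → Φ.path x B ∈ S) : Dense S := by
  have hsurj : Function.Surjective (Φ.path x) := fun z => ⟨_, Φ.path_invPath x z⟩
  refine (hsurj.denseRange.dense_image (Φ.continuous_path x) dense_primitives).mono ?_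
  rintro _ ⟨B, ⟨β, hβ, hB⟩, rfl⟩
  exact hS B β hβ hB

/-- It suffices that `B` be the affine function through the flow preimages of the two prescribed
values. -/
theorem exists_mem_localQuadVarClass (Φ : ParamFlow σ) {T : RefiningPartitions}
    (hσ : Continuous fun p : ℝ × ℝ => σ p.1 p.2) {x : C(unitInterval, ℝ)}
    (hx : HasQuadVar T x (fun t => (t : ℝ))) {t₀ t₁ : unitInterval} (h : t₀ < t₁) (z₀ z₁ : ℝ) :
    ∃ z ∈ localQuadVarClass T (fun t ξ => σ t ξ ^ 2), z t₀ = z₀ ∧ z t₁ = z₁ := by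
  have h' : (t₁ : ℝ) - t₀ ≠ 0 := sub_ne_zero.2 (ne_of_gt h)
  set c₀ := Φ.φ (t₀, z₀, -x t₀)
  set c₁ := Φ.φ (t₁, z₁, -x t₁)
  let B : C(unitInterval, ℝ) :=
    ⟨fun t => c₀ + (c₁ - c₀) / (t₁ - t₀) * (t - t₀), by fun_prop⟩
  have hB : ∀ t, B t = c₀ + (c₁ - c₀) / (t₁ - t₀) * (t - t₀) := fun _ => rfl
  refine ⟨Φ.path x B, Φ.path_mem_localQuadVarClass hσ hx
    (β := fun _ => (c₁ - c₀) / (t₁ - t₀)) continuous_const (fun t => ?_),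
    Φ.path_apply_of_eq ?_, Φ.path_apply_of_eq ?_⟩
  · rw [timeIntegral_const, hB, hB, Set.Icc.coe_zero]; ring
  · rw [hB, sub_self, mul_zero, add_zero]
  · rw [hB, div_mul_cancel₀ _ h', add_sub_cancel]

end ParamFlow

/-! ### Extension of `σ` to all times -/

/-- A smooth reparametrization of time with values in `I` which is the identity on `[0,1]`. -/
theorem exists_time_cutoff {I : Set ℝ} (hI_open : IsOpen I) (hI_conn : I.OrdConnected)
    (hI : Set.Icc (0 : ℝ) 1 ⊆ I) :
    ∃ h : ℝ → ℝ, ContDiff ℝ 2 h ∧ (∀ t, h t ∈ I) ∧ (∀ t ∈ Set.Icc (0 : ℝ) 1, h t = t) ∧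
      ∃ C, ∀ t, |deriv h t| ≤ C := by
  have hball : Metric.closedBall (1 / 2 : ℝ) (1 / 2) = Set.Icc 0 1 := by
    rw [Real.closedBall_eq_Icc]; norm_num
  obtain ⟨δ, hδ, hδI⟩ := (isCompact_Icc (a := (0 : ℝ)) (b := 1)).exists_cthickening_subset_open
    hI_open hI
  let f : ContDiffBump (1 / 2 : ℝ) := ⟨1 / 2, 1 / 2 + δ, by norm_num, by linarith⟩
  -- With a bump `f` equal to `1` on `[0,1]`, `1/2 + g t` is a convex combination of `1/2` and `t`,
  -- and `t` lies in `I` wherever `f t ≠ 0`. Compact support of `g` bounds its derivative.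
  set g : ℝ → ℝ := fun t => f t * (t - 1 / 2) with hg
  have hgc : ContDiff ℝ 2 g := f.contDiff.mul (contDiff_id.sub contDiff_const)
  have hgs : HasCompactSupport g := f.hasCompactSupport.mul_right
  refine ⟨fun t => 1 / 2 + g t, contDiff_const.add hgc, fun t => ?_, fun t ht => ?_, ?_⟩
  · have hhalf : (1 / 2 : ℝ) ∈ I := hI (by norm_num)
    by_cases h0 : f t = 0
    · simpa [hg, h0] using hhalf
    · have ht : t ∈ Metric.ball (1 / 2 : ℝ) (1 / 2 + δ) := by
        rw [← show f.rOut = 1 / 2 + δ from rfl, ← f.support_eq]; exact h0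
      have htI : t ∈ I := by
        refine hδI ?_
        rw [← hball, cthickening_closedBall hδ.le (by norm_num), add_comm δ]
        exact Metric.ball_subset_closedBall ht
      have := hI_conn.convex hhalf htI (a := 1 - f t) (b := f t) (by linarith [f.le_one (x := t)])
        f.nonneg (by ring)
      convert this using 1
      simp only [hg, smul_eq_mul]; ring
  · have : f t = 1 := f.one_of_mem_closedBall (by
      rw [show f.rIn = 1 / 2 from rfl, hball]; exact ht)
    simp [hg, this]
  · obtain ⟨C, hC⟩ := (hgc.continuous_deriv one_le_two).bounded_above_of_compact_support hgs.deriv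
    exact ⟨C, fun t => by rw [deriv_const_add]; exact hC t⟩

theorem exists_paramFlow {I : Set ℝ} (hI_open : IsOpen I) {h : ℝ → ℝ} (hh : ContDiff ℝ 2 h)
    (hhI : ∀ t, h t ∈ I) {C : ℝ} (hC : ∀ t, |deriv h t| ≤ C) {σ : ℝ → ℝ → ℝ}
    (hσ : ContDiffOn ℝ 2 (fun p : ℝ × ℝ => σ p.1 p.2) (I ×ˢ Set.univ))
    (hσ_t : ∃ M : ℝ, ∀ t ∈ I, ∀ ξ : ℝ, |deriv (fun s => σ s ξ) t| ≤ M)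
    (hσ_ξ : ∃ M : ℝ, ∀ t ∈ I, ∀ ξ : ℝ, |deriv (fun y => σ t y) ξ| ≤ M) :
    ContDiff ℝ 2 (fun p : ℝ × ℝ => σ (h p.1) p.2) ∧ Nonempty (ParamFlow fun t => σ (h t)) := by
  obtain ⟨M₁, hM₁⟩ := hσ_t
  obtain ⟨M₂, hM₂⟩ := hσ_ξ
  have hcd : ContDiff ℝ 2 (fun p : ℝ × ℝ => σ (h p.1) p.2) := by
    rw [← contDiffOn_univ] at hh ⊢
    exact hσ.comp (t := I ×ˢ Set.univ)
      (f := fun p : ℝ × ℝ => (h p.1, p.2)) ((hh.comp contDiffOn_fst fun _ _ => trivial).prodMk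
        contDiffOn_snd) fun p _ => ⟨hhI p.1, trivial⟩
  refine ⟨hcd, nonempty_paramFlow (M := max (M₁ * C) M₂) hcd (fun t u => ?_) fun t u =>
    (hM₂ (h t) (hhI t) u).trans (le_max_right _ _)⟩
  have hd : DifferentiableAt ℝ (fun s => σ s u) (h t) := by
    have h1 : DifferentiableAt ℝ (fun p : ℝ × ℝ => σ p.1 p.2) (h t, u) :=
      (hσ.differentiableOn two_ne_zero).differentiableAt
        ((hI_open.prod isOpen_univ).mem_nhds ⟨hhI t, trivial⟩)
    exact h1.comp (h t) (f := fun s => (s, u)) (by fun_prop)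
  have hdh : DifferentiableAt ℝ h t := (hh.differentiable two_ne_zero).differentiableAt
  have heq : deriv (fun s => σ (h s) u) t = deriv (fun s => σ s u) (h t) * deriv h t :=
    (hd.hasDerivAt.comp t hdh.hasDerivAt).deriv
  rw [heq, abs_mul]
  exact (mul_le_mul (hM₁ _ (hhI t) u) (hC t) (abs_nonneg _)
    ((abs_nonneg _).trans (hM₁ _ (hhI t) u))).trans (le_max_left _ _)

end PathwiseIto

end

theorem mainTheorem2
    (T : PathwiseIto.RefiningPartitions)
    (I : Set ℝ) (hI_open : IsOpen I) (hI_conn : I.OrdConnected) (hI : Set.Icc (0 : ℝ) 1 ⊆ I)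
    (σ : ℝ → ℝ → ℝ)
    (hσ : ContDiffOn ℝ 2 (fun p : ℝ × ℝ => σ p.1 p.2) (I ×ˢ Set.univ))
    (hσ_t : ∃ M : ℝ, ∀ t ∈ I, ∀ ξ : ℝ, |deriv (fun s => σ s ξ) t| ≤ M)
    (hσ_ξ : ∃ M : ℝ, ∀ t ∈ I, ∀ ξ : ℝ, |deriv (fun y => σ t y) ξ| ≤ M)
    (x : C(unitInterval, ℝ)) (hx0 : x 0 = 0)
    (hx : PathwiseIto.HasQuadVar T x (fun t => (t : ℝ))) :
    -- (a) the (unique) solution with a suitable constant drift hits `z₁` at time `t₀`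
    (∀ (z₀ z₁ : ℝ) (t₀ : unitInterval), 0 < t₀ →
      ∃ (b : ℝ) (z : C(unitInterval, ℝ)),
        PathwiseIto.IsItoSolution T x (fun t ξ => σ t ξ) (fun _ _ => b) z₀ z ∧
        (∀ w : C(unitInterval, ℝ),
          PathwiseIto.IsItoSolution T x (fun t ξ => σ t ξ) (fun _ _ => b) z₀ w → w = z) ∧
        z t₀ = z₁) ∧
    -- (b) the solutions with continuous time-dependent drift are dense
    Dense {z : C(unitInterval, ℝ) | ∃ (b : C(unitInterval, ℝ)) (z₀ : ℝ),
      PathwiseIto.IsItoSolution T x (fun t ξ => σ t ξ) (fun t _ => b t) z₀ z} ∧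
    -- the class of functions with local quadratic variation is dense
    Dense (PathwiseIto.localQuadVarClass T (fun t ξ => σ t ξ ^ 2)) ∧
    -- its members connect any two points within any nondegenerate time interval
    (∀ (t₀ t₁ : unitInterval), t₀ < t₁ → ∀ z₀ z₁ : ℝ,
      ∃ z ∈ PathwiseIto.localQuadVarClass T (fun t ξ => σ t ξ ^ 2), z t₀ = z₀ ∧ z t₁ = z₁) := by
  obtain ⟨h, hh, hhI, hid, C, hC⟩ := PathwiseIto.exists_time_cutoff hI_open hI_conn hI
  obtain ⟨hcd, ⟨Φ⟩⟩ := PathwiseIto.exists_paramFlow hI_open hh hhI hC hσ hσ_t hσ_ξ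
  -- All four claims see `σ` only at times in `[0,1]`, where `h` is the identity.
  have hσh : (fun (t : unitInterval) (ξ : ℝ) => σ t ξ) =
      fun (t : unitInterval) (ξ : ℝ) => σ (h t) ξ := by
    funext t ξ
    rw [hid t t.2]
  have hσh2 : (fun (t : unitInterval) (ξ : ℝ) => σ t ξ ^ 2) =
      fun (t : unitInterval) (ξ : ℝ) => σ (h t) ξ ^ 2 := by
    funext t ξ
    rw [hid t t.2]
  rw [hσh, hσh2]
  refine ⟨fun z₀ z₁ t₀ ht₀ => Φ.exists_constant_drift hcd hx0 hx z₀ z₁ ht₀,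
    Φ.dense_of_forall_path_mem (x := x) fun B β hβ hB => ?_,
    Φ.dense_of_forall_path_mem (x := x) fun B β hβ hB =>
      Φ.path_mem_localQuadVarClass hcd.continuous hx hβ hB,
    fun t₀ t₁ h01 z₀ z₁ => Φ.exists_mem_localQuadVarClass hcd.continuous hx h01 z₀ z₁⟩
  exact ⟨⟨fun t => Φ.slopeB x B t * β t + Φ.itoDrift x B t,
    ((Φ.continuous_slopeB x B).mul hβ).add (Φ.continuous_itoDrift x B)⟩, B 0,
    Φ.isItoSolution_path hcd hx0 hx hβ hB fun _ => rfl⟩
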